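/- Let $d,\sigma\ge 1$ be integers, $\mu\in\{1,-1\}$, $\mathbb T=\mathbb R/2\pi\mathbb Z$, and consider the nonlinear Schrödinger equation $$ i\partial_t\psi+\tfrac12\Delta\psi=\mu|\psi|^{2\sigma}\psi,\qquad x\in\mathbb T^d, \tag{1}$$ and the renormalized cubic equation $$ i\partial_t\psi+\tfrac12\Delta\psi=\mu|\psi|^{2}\psi-\frac{2\mu}{(2\pi)^d}\Big(\int_{\mathbb T^d}|\psi(t,x)|^2\,dx\Big)\psi,\qquad x\in\mathbb T^d. \tag{2}$$ For $s\in\mathbb R$ and $p\in[1,\infty]$ let $\mathcal FL^{s,p}(\mathbb T^d)$ be the space of distributions $f\in\mathcal D'(\mathbb T^d,\mathbb C)$ with $\langle\cdot\rangle^s\hat f\in\ell^p(\mathbb Z^d)$, normed by $\|f\|_{\mathcal FL^{s,p}}=\|\langle\cdot\rangle^s\hat f\|_{\ell^p}$, where $\langle k\rangle=(1+|k|^2)^{1/2}$ and $\hat f(k)=(2\pi)^{-d}\langle f,e^{-ik\cdot x}\rangle$; in particular $H^s=\mathcal FL^{s,2}$. A smooth solution is a function $\psi\in C^\infty(J\times\mathbb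 T^d,\mathbb C)$ that solves the equation on $J\times\mathbb T^d$, where $J\ni 0$ is an open interval; for $T>0$, $\|\psi\|_{L^\infty(0,T;X)}$ denotes the essential supremum of $\|\psi(t)\|_X$ over $t\in(0,T)\cap J$ (that is, over the times in $(0,T)$ at which $\psi$ is defined). Let $p_1,p_2\in[1,\infty]$, $T>0$ and $s\in\mathbb R$, and assume * in the case of (1): either $d\sigma\ge2$ and $s<0$, or $d=\sigma=1$ and $s<-2/3$; * in the case of (2): either $d\ge2$ and $s<0$, or $d=1$ and $s<-2/3$. Then for no $r\in\mathbb R$ do there exist a neighborhood $U$ of $0$ in $\mathcal FL^{s,p_1}(\mathbb T^d)$ and a continuous function $M_r:\mathbb R_{\ge0}\to\mathbb R_{\ge0}$ such that every smooth solution $\psi$ of (1) (respectively of (2)) with $\psi(0)\in U$ satisfies $$\|\psi\|_{L^\infty(0,T;\mathcal FL^{r,p_2}(\mathbb T^d))}\le M_r\big(\|\psi(0)\|_{\mathcal FL^{s,p_1}(\mathbb T^d)}\big).$$ In particular, for no $r\in\mathbb R$ is there a continuous function $M_r:\mathbb R_{\ge0}\to\mathbb R_{\ge0}$ such that every smooth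 solution $\psi$ of (1) (respectively of (2)) satisfies $\|\psi\|_{L^\infty(0,T;H^r(\mathbb T^d))}\le M_r(\|\psi(0)\|_{H^s(\mathbb T^d)})$. -/

import Mathlib

open scoped ENNReal NNReal Topology ContDiff

noncomputable section

namespace PeriodicNLS

/-- `C^∞(𝕋^d, ℂ)` for `𝕋 = ℝ / 2πℤ`: the smooth functions on `ℝ^d` that are `2π`-periodic in every
variable. -/
def SmoothTorus (d : ℕ) : Submodule ℂ ((Fin d → ℝ) → ℂ) where
  carrier := {f | ContDiff ℝ ∞ f ∧ ∀ x i, f (x + Pi.single i (2 * Real.pi)) = f x}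
  add_mem' := fun {f g} hf hg =>
    ⟨hf.1.add hg.1, fun x i => by simp only [Pi.add_apply, hf.2 x i, hg.2 x i]⟩
  zero_mem' := ⟨contDiff_const, fun _ _ => rfl⟩
  smul_mem' := fun c f hf =>
    ⟨contDiff_const.smul hf.1, fun x i => by simp only [Pi.smul_apply, hf.2 x i]⟩

instance (d : ℕ) : CoeFun (SmoothTorus d) (fun _ => (Fin d → ℝ) → ℂ) := ⟨fun f => f.1⟩

/-- The fundamental cell `[0, 2π]^d`; integrals over `𝕋^d` are integrals over it. -/
def cell (d : ℕ) : Set (Fin d → ℝ) := Set.Icc 0 (fun _ => 2 * Real.pi)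

/-- `𝒟'(𝕋^d, ℂ)`: the linear functionals on `C^∞(𝕋^d)` that are continuous, that is, bounded by a
constant times the largest of the sup norms of the derivatives up to some order `N`. -/
def TorusDistribution (d : ℕ) : Submodule ℂ (SmoothTorus d →ₗ[ℂ] ℂ) where
  carrier := {u | ∃ (N : ℕ) (C : ℝ), ∀ (φ : SmoothTorus d) (B : ℝ),
    (∀ n ≤ N, ∀ x, ‖iteratedFDeriv ℝ n φ.1 x‖ ≤ B) → ‖u φ‖ ≤ C * B}
  add_mem' := by
    rintro u v ⟨N, C, hu⟩ ⟨N', C', hv⟩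
    refine ⟨max N N', C + C', fun φ B hB => ?_⟩
    have h1 := hu φ B fun n hn => hB n (hn.trans (le_max_left _ _))
    have h2 := hv φ B fun n hn => hB n (hn.trans (le_max_right _ _))
    calc ‖(u + v) φ‖ ≤ ‖u φ‖ + ‖v φ‖ := norm_add_le _ _
      _ ≤ (C + C') * B := by linarith
  zero_mem' := ⟨0, 0, fun φ B _ => by simp⟩
  smul_mem' := by
    rintro c u ⟨N, C, hu⟩
    refine ⟨N, ‖c‖ * C, fun φ B hB => ?_⟩
    rw [LinearMap.smul_apply, norm_smul, mul_assoc]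
    exact mul_le_mul_of_nonneg_left (hu φ B hB) (norm_nonneg c)

theorem integrableOn_cell {d : ℕ} {f : (Fin d → ℝ) → ℂ} (hf : Continuous f) :
    MeasureTheory.IntegrableOn f (cell d) :=
  hf.continuousOn.integrableOn_compact isCompact_Icc

/-- A smooth function as a distribution, `φ ↦ ∫_{𝕋^d} f φ`. -/
def toDistribution {d : ℕ} (f : SmoothTorus d) : TorusDistribution d :=
  ⟨{ toFun := fun φ => ∫ x in cell d, f x * φ x
     map_add' := fun φ χ => by
       have h := MeasureTheory.integral_add
         (integrableOn_cell (f.2.1.continuous.mul φ.2.1.continuous))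
         (integrableOn_cell (f.2.1.continuous.mul χ.2.1.continuous))
       refine Eq.trans ?_ h
       congr 1
       funext x
       exact mul_add _ _ _
     map_smul' := fun c φ => by
       rw [RingHom.id_apply, smul_eq_mul, ← MeasureTheory.integral_const_mul]
       congr 1
       funext x
       exact mul_left_comm _ _ _ },
   by
    refine ⟨0, ∫ x in cell d, ‖f x‖, fun φ B hB => ?_⟩
    rw [← MeasureTheory.integral_mul_const]
    refine MeasureTheory.norm_integral_le_of_norm_le
      ((integrableOn_cell f.2.1.continuous).norm.mul_const B)
      (Filter.Eventually.of_forall fun x => ?_)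
    have h := hB 0 le_rfl x
    rw [norm_iteratedFDeriv_zero] at h
    rw [norm_mul]
    exact mul_le_mul_of_nonneg_left h (norm_nonneg _)⟩

/-- The character `x ↦ e^{i k · x}`. -/
def character {d : ℕ} (k : Fin d → ℤ) : SmoothTorus d :=
  ⟨fun x => Complex.exp (Complex.I * ((∑ j, (k j : ℝ) * x j : ℝ) : ℂ)), by
    refine ⟨?_, fun x i => ?_⟩
    · have h : ContDiff ℝ ∞ (fun x : Fin d → ℝ => ∑ j, (k j : ℝ) * x j) :=
        ContDiff.sum fun (j : Fin d) _ => contDiff_const.mul (contDiff_apply ℝ ℝ j)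
      exact (contDiff_const.mul (Complex.ofRealCLM.contDiff.comp h)).cexp
    · have h : (∑ j, (k j : ℝ) * (x + Pi.single i (2 * Real.pi) : Fin d → ℝ) j)
          = (∑ j, (k j : ℝ) * x j) + (k i : ℝ) * (2 * Real.pi) := by
        simp [mul_add, Finset.sum_add_distrib, Pi.single_apply]
      beta_reduce
      rw [h]
      refine Complex.exp_eq_exp_iff_exists_int.2 ⟨k i, ?_⟩
      push_cast
      ring⟩

/-- The Fourier coefficient `û(k) = (2π)^{-d} ⟨u, e^{-i k · x}⟩`. -/
def distFourierCoeff {d : ℕ} (u : TorusDistribution d) (k : Fin d → ℤ) : ℂ :=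
  ((2 * Real.pi : ℝ) ^ d : ℂ)⁻¹ * u.1 (character (-k))

/-- The weighted Fourier coefficients `⟨k⟩^s û(k)`, where `⟨k⟩ = (1 + |k|²)^{1/2}`. -/
def weightedCoeff {d : ℕ} (s : ℝ) (u : TorusDistribution d) (k : Fin d → ℤ) : ℂ :=
  ((Real.sqrt (1 + ∑ j, (k j : ℝ) ^ 2) ^ s : ℝ) : ℂ) * distFourierCoeff u k

theorem weightedCoeff_add {d : ℕ} (s : ℝ) (u v : TorusDistribution d) :
    weightedCoeff s (u + v) = weightedCoeff s u + weightedCoeff s v := by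
  funext k
  simp [weightedCoeff, distFourierCoeff, mul_add]

theorem weightedCoeff_smul {d : ℕ} (s : ℝ) (c : ℂ) (u : TorusDistribution d) :
    weightedCoeff s (c • u) = c • weightedCoeff s u := by
  funext k
  simp [weightedCoeff, distFourierCoeff, mul_left_comm]

/-- The Fourier-Lebesgue space `ℱL^{s,p}(𝕋^d)`: the distributions with `⟨·⟩^s û ∈ ℓ^p(ℤ^d)`. -/
def FL (d : ℕ) (s : ℝ) (p : ℝ≥0∞) : Submodule ℂ (TorusDistribution d) where
  carrier := {u | Memℓp (weightedCoeff s u) p}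
  add_mem' := fun {u v} hu hv => by
    have h := Memℓp.add hu hv
    rwa [← weightedCoeff_add] at h
  zero_mem' := by
    have h : weightedCoeff s (0 : TorusDistribution d) = 0 := by
      funext k
      simp [weightedCoeff, distFourierCoeff]
    change Memℓp (weightedCoeff s (0 : TorusDistribution d)) p
    rw [h]
    exact zero_memℓp
  smul_mem' := fun c u hu => by
    have h := Memℓp.const_smul hu c
    rwa [← weightedCoeff_smul] at h

/-- The map `u ↦ ⟨·⟩^s û` from `ℱL^{s,p}(𝕋^d)` to `ℓ^p(ℤ^d)`. -/
def FL.toLp (d : ℕ) (s : ℝ) (p : ℝ≥0∞) : FL d s p →ₗ[ℂ] lp (fun _ : Fin d → ℤ => ℂ) p where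
  toFun := fun u => ⟨weightedCoeff s u.1, u.2⟩
  map_add' := fun u v => Subtype.ext (weightedCoeff_add s u.1 v.1)
  map_smul' := fun c u => Subtype.ext (weightedCoeff_smul s c u.1)

/-- The norm `‖u‖_{ℱL^{s,p}} = ‖⟨·⟩^s û‖_{ℓ^p}`, and the topology that it defines. -/
instance FL.instSeminormedAddCommGroup (d : ℕ) (s : ℝ) (p : ℝ≥0∞) [Fact (1 ≤ p)] :
    SeminormedAddCommGroup (FL d s p) :=
  SeminormedAddCommGroup.induced (FL d s p) (lp (fun _ : Fin d → ℤ => ℂ) p) (FL.toLp d s p)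

/-- The Sobolev space `H^s(𝕋^d) = ℱL^{s,2}(𝕋^d)`. -/
abbrev Sobolev (d : ℕ) (s : ℝ) : Submodule ℂ (TorusDistribution d) := FL d s 2

/-- `‖u‖_{ℱL^{s,p}}` for an arbitrary distribution `u`, with the value `∞` if `u ∉ ℱL^{s,p}`. -/
def flENorm {d : ℕ} (s : ℝ) (p : ℝ≥0∞) [Fact (1 ≤ p)] (u : TorusDistribution d) : ℝ≥0∞ :=
  ⨅ h : u ∈ FL d s p, ‖(⟨u, h⟩ : FL d s p)‖ₑ

/-- `Δ = ∑ₖ ∂²/∂xₖ²`. -/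
def torusLaplacian {d : ℕ} (f : (Fin d → ℝ) → ℂ) (x : Fin d → ℝ) : ℂ :=
  ∑ k, iteratedDeriv 2 (fun y : ℝ => f (Function.update x k y)) (x k)

/-- The nonlinearity `μ |ψ|^{2σ} ψ`. -/
def nlsTerm {d : ℕ} (μ : ℝ) (σ : ℕ) (f : SmoothTorus d) (x : Fin d → ℝ) : ℂ :=
  (μ : ℂ) * ((‖f x‖ ^ (2 * σ) : ℝ) : ℂ) * f x

/-- The renormalized cubic nonlinearity `μ |ψ|² ψ - (2μ / (2π)^d) (∫_{𝕋^d} |ψ|²) ψ`. -/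
def renormalizedTerm {d : ℕ} (μ : ℝ) (f : SmoothTorus d) (x : Fin d → ℝ) : ℂ :=
  (μ : ℂ) * ((‖f x‖ ^ 2 : ℝ) : ℂ) * f x
    - ((2 * μ / (2 * Real.pi) ^ d * ∫ y in cell d, ‖f y‖ ^ 2 : ℝ) : ℂ) * f x

/-- `ψ` is a smooth solution of `i ∂ₜψ + ½ Δψ = F(ψ)` on `J × 𝕋^d`, where `J` is an open interval of
times with `0 ∈ J`. The values of `ψ` at times outside `J` play no role. -/
structure IsSmoothSolution {d : ℕ} (F : SmoothTorus d → (Fin d → ℝ) → ℂ) (J : Set ℝ)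
    (ψ : ℝ → SmoothTorus d) : Prop where
  isOpen : IsOpen J
  ordConnected : J.OrdConnected
  zero_mem : (0 : ℝ) ∈ J
  contDiffOn : ContDiffOn ℝ ∞ (fun q : ℝ × (Fin d → ℝ) => ψ q.1 q.2) (J ×ˢ Set.univ)
  equation : ∀ t ∈ J, ∀ x,
    Complex.I * deriv (fun τ => ψ τ x) t + (1 / 2 : ℂ) * torusLaplacian (ψ t) x = F (ψ t) x

/-- `‖ψ‖_{L^∞(0,T; ℱL^{r,p})}` for a function `ψ` with time interval `J`: the essential supremum
over the times in `(0,T)` at which `ψ` is defined. -/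
def timeSupNorm {d : ℕ} (r : ℝ) (p : ℝ≥0∞) [Fact (1 ≤ p)] (T : ℝ) (J : Set ℝ)
    (ψ : ℝ → SmoothTorus d) : ℝ≥0∞ :=
  essSup (fun t => flENorm r p (toDistribution (ψ t)))
    (MeasureTheory.volume.restrict (Set.Ioo 0 T ∩ J))

/-- The a priori estimate `‖ψ‖_{L^∞(0,T; ℱL^{r,p₂})} ≤ M(‖ψ(0)‖_{ℱL^{s,p₁}})` for all smooth solutions
of `i ∂ₜψ + ½ Δψ = F(ψ)` with `ψ(0) ∈ U`. -/
def AprioriEstimate {d : ℕ} (F : SmoothTorus d → (Fin d → ℝ) → ℂ) (s : ℝ) (p₁ : ℝ≥0∞)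
    [Fact (1 ≤ p₁)] (r : ℝ) (p₂ : ℝ≥0∞) [Fact (1 ≤ p₂)] (T : ℝ) (U : Set (FL d s p₁))
    (M : ℝ≥0 → ℝ≥0) : Prop :=
  ∀ (J : Set ℝ) (ψ : ℝ → SmoothTorus d), IsSmoothSolution F J ψ →
    ∀ u ∈ U, (u : TorusDistribution d) = toDistribution (ψ 0) →
      timeSupNorm r p₂ T J ψ ≤ (M ‖u‖₊ : ℝ≥0∞)

/-- The a priori estimate `‖ψ‖_{L^∞(0,T; H^r)} ≤ M(‖ψ(0)‖_{H^s})` for all smooth solutions of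
`i ∂ₜψ + ½ Δψ = F(ψ)`. -/
def SobolevAprioriEstimate {d : ℕ} (F : SmoothTorus d → (Fin d → ℝ) → ℂ) (s r T : ℝ)
    (M : ℝ≥0 → ℝ≥0) : Prop :=
  ∀ (J : Set ℝ) (ψ : ℝ → SmoothTorus d), IsSmoothSolution F J ψ →
    ∀ u : Sobolev d s, (u : TorusDistribution d) = toDistribution (ψ 0) →
      timeSupNorm r 2 T J ψ ≤ (M ‖u‖₊ : ℝ≥0∞)

end PeriodicNLS

end

open PeriodicNLS

namespace PeriodicNLS

noncomputable section

/-! High frequencies that are small in negative regularity can interact to create a large zero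
Fourier mode. That mode is bounded by every `ℱL^{r,p}` norm because its weight is `1`, so the values
of `r` and `p₂` do not matter. The data are `A ∑ⱼ e^{i N kⱼ · x}` with fixed nonzero `kⱼ`. Their
`ℱL^{s,p₁}` norm is at most a constant times `N^s A`, and their mean is zero. By `exists_solution`,
the zero mode at time `t` has size `A^{2σ+1} |∫₀ᵗ phaseSum|` up to an error `O(A^{4σ+1} t²)`, as
long as `A^{2σ} t` is small. The function `phaseSum` collects the tuples with vanishing alternating
frequency sum, each oscillating at `N²/2` times the alternating sum of the `|kⱼ|²`. An a priori
estimate would bound this mode by a fixed constant (`zeroMode_bound_of_aprioriEstimate`).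

If `dσ ≥ 2`, some tuple of nonzero frequencies is resonant: both alternating sums vanish
(`exists_resonant_tuple`). As `N → ∞` the nonresonant terms average out
(`phaseSum_integral_lower_of_resonant`). With `t = δ A^{-2σ}` the mode is then at least of order `δ
A`, and `A` is arbitrary. If `d = σ = 1`, no such resonance exists, since `k₁² + k₃² = (k₁ + k₃)²`
forces `k₁ k₃ = 0`. Instead one takes `t = c N^{-2}`, before the phases can cancel
(`phaseSum_integral_lower_of_short`), and `A = N^a`. The mode grows like `N^{3a-2}`, so `a > 2/3` is
needed, while smallness of the data needs `a < -s`.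

For the renormalized equation the extra term does not affect the zero mode of a mean-zero function,
so the same first iterate appears.

Smooth solutions come from an ODE in a graded `ℓ¹` algebra. Coefficients are indexed by a degree `n`
and a frequency of size at most `K n`, and the nonlinearity commutes with the weights `r ^ n`.
Multiplying an `ℓ¹` solution by `4 ^ (-n)` therefore gives another solution, now with exponentially
decaying coefficients, and every derivative is absorbed by the decay (`contDiff_phase`,
`contDiffOn_degScale`). -/

/-- `ℓ¹(ι)`. -/
abbrev L1 (ι : Type*) : Type _ := ↥(lp (fun _ : ι => ℂ) 1)

/-! ### The space `ℓ¹` and the operators determined by their values on unit vectors. -/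

section L1
variable {ι : Type*} {E : Type*} [NormedAddCommGroup E] [NormedSpace ℂ E]

theorem L1.summable_norm (a : L1 ι) : Summable fun i => ‖a i‖ := by
  have h := (lp.memℓp a).summable (by simp)
  simpa using h

theorem L1.norm_eq (a : L1 ι) : ‖a‖ = ∑' i, ‖a i‖ := by
  have h := lp.norm_eq_tsum_rpow (p := 1) (by simp) a
  simpa using h

theorem L1.summable_smul (a : L1 ι) {f : ι → E} {C : ℝ} (hf : ∀ i, ‖f i‖ ≤ C) :
    Summable fun i => ‖a i • f i‖ := by
  refine Summable.of_nonneg_of_le (fun i => norm_nonneg _) (fun i => ?_)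
    (a.summable_norm.mul_right C)
  rw [norm_smul]
  exact mul_le_mul_of_nonneg_left (hf i) (norm_nonneg _)

theorem L1.norm_tsum_smul_le (a : L1 ι) {f : ι → E} {C : ℝ} (hf : ∀ i, ‖f i‖ ≤ C) :
    ‖∑' i, a i • f i‖ ≤ C * ‖a‖ := by
  have h := L1.summable_smul a hf
  have h' : ∀ i, ‖a i • f i‖ ≤ C * ‖a i‖ := fun i => by
    rw [norm_smul, mul_comm]
    exact mul_le_mul_of_nonneg_right (hf i) (norm_nonneg _)
  calc ‖∑' i, a i • f i‖ ≤ ∑' i, ‖a i • f i‖ := norm_tsum_le_tsum_norm h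
    _ ≤ ∑' i, C * ‖a i‖ := h.tsum_le_tsum h' (a.summable_norm.mul_left C)
    _ = C * ‖a‖ := by rw [tsum_mul_left, L1.norm_eq]

section
variable [DecidableEq ι]

/-- The unit vectors of `ℓ¹(ι)`. -/
def unitVec (i : ι) : L1 ι := lp.single 1 i 1

theorem unitVec_apply (i j : ι) : unitVec i j = if j = i then 1 else 0 := by
  rw [unitVec, lp.single_apply, Pi.single_apply]

@[simp] theorem norm_unitVec (i : ι) : ‖unitVec i‖ = 1 := by
  rw [unitVec, lp.norm_single (by simp)]
  simp

theorem L1.hasSum_unitVec (a : L1 ι) : HasSum (fun i => a i • unitVec i) a := by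
  have h := lp.hasSum_single (by simp) a
  convert h using 2 with i
  rw [unitVec, ← lp.single_smul]
  simp

/-- Finite combinations of unit vectors are dense. The operator identities below are reduced to unit
vectors in this way. -/
theorem L1.clm_ext {F G : L1 ι →L[ℂ] E} (h : ∀ i, F (unitVec i) = G (unitVec i)) : F = G := by
  ext a
  have hF := (a.hasSum_unitVec.mapL F).tsum_eq
  have hG := (a.hasSum_unitVec.mapL G).tsum_eq
  rw [← hF, ← hG]
  simp [h]

end

variable [CompleteSpace E]

open Classical in
/-- The extension of a bounded family `f : ι → E` to a continuous linear map on `ℓ¹(ι)`, sending the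
unit vector `i` to `f i`. It is `0` if `f` is unbounded. -/
def l1Lift (f : ι → E) : L1 ι →L[ℂ] E :=
  if h : ∃ C, ∀ i, ‖f i‖ ≤ C then
    LinearMap.mkContinuous
      { toFun := fun a => ∑' i, a i • f i
        map_add' := fun a b => by
          obtain ⟨C, hC⟩ := h
          refine Eq.trans ?_
            ((a.summable_smul hC).of_norm.tsum_add (b.summable_smul hC).of_norm)
          exact tsum_congr fun i => add_smul _ _ _
        map_smul' := fun c a => by
          obtain ⟨C, hC⟩ := h
          refine Eq.trans ?_ ((a.summable_smul hC).of_norm.tsum_const_smul c)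
          exact tsum_congr fun i => mul_smul _ _ _ }
      h.choose (fun a => a.norm_tsum_smul_le h.choose_spec)
  else 0

variable {f : ι → E} {C : ℝ}

theorem l1Lift_apply (hf : ∀ i, ‖f i‖ ≤ C) (a : L1 ι) : l1Lift f a = ∑' i, a i • f i := by
  rw [l1Lift, dif_pos ⟨C, hf⟩]
  rfl

theorem norm_l1Lift_apply_le (hf : ∀ i, ‖f i‖ ≤ C) (a : L1 ι) : ‖l1Lift f a‖ ≤ C * ‖a‖ := by
  rw [l1Lift_apply hf]
  exact a.norm_tsum_smul_le hf

theorem norm_l1Lift_le (hC : 0 ≤ C) (hf : ∀ i, ‖f i‖ ≤ C) : ‖l1Lift f‖ ≤ C :=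
  ContinuousLinearMap.opNorm_le_bound _ hC (norm_l1Lift_apply_le hf)

variable [DecidableEq ι]

theorem l1Lift_unitVec (hf : ∀ i, ‖f i‖ ≤ C) (i : ι) : l1Lift f (unitVec i) = f i := by
  rw [l1Lift_apply hf, tsum_eq_single i]
  · simp [unitVec_apply]
  · intro j hj
    simp [unitVec_apply, hj]

/-- The multiplication operator `(aᵢ) ↦ (mᵢ aᵢ)` on `ℓ¹(ι)`, for a bounded family `m`. -/
def diag (m : ι → ℂ) : L1 ι →L[ℂ] L1 ι := l1Lift fun i => m i • unitVec i

variable {m m' : ι → ℂ} {C' : ℝ}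

theorem norm_smul_unitVec_le (hm : ∀ i, ‖m i‖ ≤ C) (i : ι) : ‖m i • unitVec i‖ ≤ C := by
  rw [norm_smul, norm_unitVec, mul_one]
  exact hm i

theorem diag_unitVec (hm : ∀ i, ‖m i‖ ≤ C) (i : ι) : diag m (unitVec i) = m i • unitVec i :=
  l1Lift_unitVec (norm_smul_unitVec_le hm) i

theorem norm_diag_le (hC : 0 ≤ C) (hm : ∀ i, ‖m i‖ ≤ C) : ‖diag m‖ ≤ C :=
  norm_l1Lift_le hC (norm_smul_unitVec_le hm)

theorem norm_diag_apply_le (hm : ∀ i, ‖m i‖ ≤ C) (a : L1 ι) : ‖diag m a‖ ≤ C * ‖a‖ :=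
  norm_l1Lift_apply_le (norm_smul_unitVec_le hm) a

theorem diag_apply (hm : ∀ i, ‖m i‖ ≤ C) (a : L1 ι) (j : ι) : diag m a j = m j * a j := by
  have h : (lp.evalCLM ℂ (fun _ : ι => ℂ) 1 j).comp (diag m)
      = m j • lp.evalCLM ℂ (fun _ : ι => ℂ) 1 j := by
    refine L1.clm_ext fun i => ?_
    rw [ContinuousLinearMap.comp_apply, diag_unitVec hm]
    change m i * unitVec i j = m j * unitVec i j
    rw [unitVec_apply]
    split_ifs with hij
    · rw [hij]
    · simp
  exact DFunLike.congr_fun h a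

theorem diag_comp (hm : ∀ i, ‖m i‖ ≤ C) (hm' : ∀ i, ‖m' i‖ ≤ C') :
    (diag m).comp (diag m') = diag fun i => m i * m' i := by
  refine L1.clm_ext fun i => ?_
  have h : ∀ i, ‖m i * m' i‖ ≤ C * C' := fun i => by
    rw [norm_mul]
    exact mul_le_mul (hm i) (hm' i) (norm_nonneg _) ((norm_nonneg _).trans (hm i))
  rw [ContinuousLinearMap.comp_apply, diag_unitVec hm', map_smul, diag_unitVec hm, diag_unitVec h,
    smul_smul, mul_comm]

theorem diag_add (hm : ∀ i, ‖m i‖ ≤ C) (hm' : ∀ i, ‖m' i‖ ≤ C') :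
    diag (fun i => m i + m' i) = diag m + diag m' := by
  refine L1.clm_ext fun i => ?_
  have h : ∀ i, ‖m i + m' i‖ ≤ C + C' := fun i =>
    (norm_add_le _ _).trans (add_le_add (hm i) (hm' i))
  rw [add_apply, diag_unitVec hm', diag_unitVec hm, diag_unitVec h, add_smul]

theorem diag_smul (c : ℂ) (hm : ∀ i, ‖m i‖ ≤ C) :
    diag (fun i => c * m i) = c • diag m := by
  refine L1.clm_ext fun i => ?_
  have h : ∀ i, ‖c * m i‖ ≤ ‖c‖ * C := fun i => by
    rw [norm_mul]
    exact mul_le_mul_of_nonneg_left (hm i) (norm_nonneg _)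
  rw [smul_apply, diag_unitVec hm, diag_unitVec h, mul_smul]

end L1

/-! ### Phase multipliers damped by the degree, and their smoothness. -/

section Phase

/-- Geometric decay in the degree beats polynomial growth. This is how the weight `r ^ deg` pays for
derivatives. -/
theorem exists_succ_pow_mul_pow_le (k : ℕ) {r : ℝ} (hr0 : 0 ≤ r) (hr1 : r < 1) :
    ∃ C : ℝ, 0 ≤ C ∧ ∀ n : ℕ, ((n : ℝ) + 1) ^ k * r ^ n ≤ C := by
  obtain ⟨B, hB⟩ := (tendsto_pow_const_mul_const_pow_of_lt_one k hr0 hr1).bddAbove_range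
  have hB' : ∀ n : ℕ, (n : ℝ) ^ k * r ^ n ≤ B := fun n => hB ⟨n, rfl⟩
  have hB0 : 0 ≤ B := le_trans (by positivity) (hB' 1)
  refine ⟨2 ^ k * B + 1, by positivity, fun n => ?_⟩
  have h1 : ((n : ℝ) + 1) ^ k ≤ (2 * n) ^ k + 1 := by
    rcases Nat.eq_zero_or_pos n with rfl | hn
    · simp
    · have : (1 : ℝ) ≤ n := by exact_mod_cast hn
      have := pow_le_pow_left₀ (by positivity) (by linarith : (n : ℝ) + 1 ≤ 2 * n) k
      linarith
  have h2 : r ^ n ≤ 1 := pow_le_one₀ hr0 hr1.le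
  have h3 : 0 ≤ r ^ n := pow_nonneg hr0 n
  calc ((n : ℝ) + 1) ^ k * r ^ n ≤ ((2 * n) ^ k + 1) * r ^ n :=
        mul_le_mul_of_nonneg_right h1 h3
    _ = 2 ^ k * (n ^ k * r ^ n) + r ^ n := by rw [mul_pow]; ring
    _ ≤ 2 ^ k * B + 1 := by gcongr; exact hB' n

/-- Taylor's formula covers `|y| ≤ 1`. For larger `|y|` the trivial bound `2 + |y|` is already below
`3 y²`. -/
theorem norm_exp_I_sub_one_sub_le (y : ℝ) :
    ‖Complex.exp (Complex.I * y) - 1 - Complex.I * y‖ ≤ 3 * y ^ 2 := by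
  have hn : ‖Complex.I * (y : ℂ)‖ = |y| := by simp
  by_cases hy : |y| ≤ 1
  · have h := Complex.norm_exp_sub_one_sub_id_le (x := Complex.I * y) (by rwa [hn])
    rw [hn, sq_abs] at h
    nlinarith [sq_nonneg y]
  · have h1 : ‖Complex.exp (Complex.I * y)‖ = 1 := by
      rw [mul_comm]
      exact Complex.norm_exp_ofReal_mul_I y
    have h2 : ‖Complex.exp (Complex.I * y) - 1 - Complex.I * y‖ ≤ 1 + 1 + |y| := by
      refine (norm_sub_le _ _).trans (add_le_add ((norm_sub_le _ _).trans ?_) hn.le)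
      rw [h1, norm_one]
    push Not at hy
    nlinarith [sq_abs y]

variable {ι : Type*} {Q : Type*} [NormedAddCommGroup Q] [NormedSpace ℝ Q]

/-- The symbol `r ^ deg i * e^{i θᵢ(q)}`. -/
def phaseSymbol (deg : ι → ℕ) (θ : ι → Q →L[ℝ] ℝ) (r : ℝ) (q : Q) (i : ι) : ℂ :=
  (r : ℂ) ^ deg i * Complex.exp (Complex.I * (θ i q : ℝ))

variable {deg : ι → ℕ} {θ : ι → Q →L[ℝ] ℝ}

theorem norm_phaseSymbol {r : ℝ} (hr : 0 ≤ r) (q : Q) (i : ι) :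
    ‖phaseSymbol deg θ r q i‖ = r ^ deg i := by
  rw [phaseSymbol, norm_mul, mul_comm Complex.I, Complex.norm_exp_ofReal_mul_I, mul_one, norm_pow,
    Complex.norm_real, Real.norm_of_nonneg hr]

theorem norm_phaseSymbol_le {r : ℝ} (hr : 0 ≤ r) (hr1 : r ≤ 1) (q : Q) (i : ι) :
    ‖phaseSymbol deg θ r q i‖ ≤ 1 := by
  rw [norm_phaseSymbol hr]
  exact pow_le_one₀ hr hr1

theorem exists_norm_symbol_le {C : ℝ} (hθ : ∀ i, ‖θ i‖ ≤ C * ((deg i : ℝ) + 1) ^ 2) {r : ℝ}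
    (hr : 0 ≤ r) (hr1 : r < 1) :
    ∃ B : ℝ, 0 ≤ B ∧ ∀ h i, ‖Complex.I * (θ i h : ℝ) * (r : ℂ) ^ deg i‖ ≤ B * ‖h‖ := by
  obtain ⟨B, hB0, hB⟩ := exists_succ_pow_mul_pow_le 2 hr hr1
  refine ⟨|C| * B, by positivity, fun h i => ?_⟩
  have h1 : |θ i h| ≤ |C| * ((deg i : ℝ) + 1) ^ 2 * ‖h‖ :=
    ((θ i).le_opNorm h).trans (mul_le_mul_of_nonneg_right
      ((hθ i).trans (mul_le_mul_of_nonneg_right (le_abs_self C) (by positivity))) (norm_nonneg _))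
  rw [norm_mul, norm_mul, norm_pow, Complex.norm_I, one_mul, Complex.norm_real, Complex.norm_real,
    Real.norm_eq_abs, Real.norm_of_nonneg hr]
  calc |θ i h| * r ^ deg i ≤ |C| * ((deg i : ℝ) + 1) ^ 2 * ‖h‖ * r ^ deg i :=
        mul_le_mul_of_nonneg_right h1 (by positivity)
    _ = |C| * (((deg i : ℝ) + 1) ^ 2 * r ^ deg i) * ‖h‖ := by ring
    _ ≤ |C| * B * ‖h‖ := by gcongr; exact hB _

variable [DecidableEq ι]

variable (deg θ) in
/-- The multiplication operator `(aᵢ) ↦ (r ^ deg i * e^{i θᵢ(q)} aᵢ)`. -/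
def phase (r : ℝ) (q : Q) : L1 ι →L[ℂ] L1 ι :=
  diag (phaseSymbol deg θ r q)

theorem phase_unitVec {r : ℝ} (hr : 0 ≤ r) (hr1 : r ≤ 1) (q : Q) (i : ι) :
    phase deg θ r q (unitVec i) = phaseSymbol deg θ r q i • unitVec i :=
  diag_unitVec (norm_phaseSymbol_le hr hr1 q) i

theorem norm_phase_apply_le {r : ℝ} (hr : 0 ≤ r) (hr1 : r ≤ 1) (q : Q) (a : L1 ι) :
    ‖phase deg θ r q a‖ ≤ ‖a‖ := by
  have h := norm_diag_apply_le (norm_phaseSymbol_le (deg := deg) (θ := θ) hr hr1 q) a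
  rwa [one_mul] at h

theorem phase_comp {r s : ℝ} (hr : 0 ≤ r) (hr1 : r ≤ 1) (hs : 0 ≤ s) (hs1 : s ≤ 1) (q q' : Q) :
    (phase deg θ r q).comp (phase deg θ s q') = phase deg θ (r * s) (q + q') := by
  rw [phase, phase, diag_comp (norm_phaseSymbol_le hr hr1 q) (norm_phaseSymbol_le hs hs1 q')]
  congr 1
  funext i
  simp only [phaseSymbol, map_add, Complex.ofReal_add, mul_add, Complex.exp_add,
    Complex.ofReal_mul, mul_pow]
  ring

theorem phase_phase {r s : ℝ} (hr : 0 ≤ r) (hr1 : r ≤ 1) (hs : 0 ≤ s) (hs1 : s ≤ 1) (q q' : Q)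
    (a : L1 ι) : phase deg θ r q (phase deg θ s q' a) = phase deg θ (r * s) (q + q') a := by
  rw [← phase_comp hr hr1 hs hs1]
  rfl

/-- Strong continuity by dominated convergence of the series. It includes `r = 1`, where continuity
in operator norm may fail because the `θ i` may be unbounded. -/
theorem continuous_phase_apply {r : ℝ} (hr : 0 ≤ r) (hr1 : r ≤ 1) (a : L1 ι) :
    Continuous fun q => phase deg θ r q a := by
  have h : (fun q => phase deg θ r q a)
      = fun q => ∑' i, a i • (phaseSymbol deg θ r q i • unitVec i) := by
    funext q
    exact l1Lift_apply (norm_smul_unitVec_le (norm_phaseSymbol_le hr hr1 q)) a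
  rw [h]
  refine continuous_tsum (u := fun i => ‖a i‖) (fun i => ?_) a.summable_norm (fun i q => ?_)
  · unfold phaseSymbol
    fun_prop
  · rw [norm_smul]
    exact mul_le_of_le_one_right (norm_nonneg _)
      (norm_smul_unitVec_le (norm_phaseSymbol_le hr hr1 q) i)

theorem continuous_phase_apply_of_continuous {r : ℝ} (hr : 0 ≤ r) (hr1 : r ≤ 1) {Y : Type*}
    [TopologicalSpace Y] {q : Y → Q} {a : Y → L1 ι} (hq : Continuous q) (ha : Continuous a) :
    Continuous fun y => phase deg θ r (q y) (a y) := by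
  rw [continuous_iff_continuousAt]
  intro y₀
  have h1 : Filter.Tendsto (fun y => phase deg θ r (q y) (a y₀)) (𝓝 y₀)
      (𝓝 (phase deg θ r (q y₀) (a y₀))) :=
    ((continuous_phase_apply hr hr1 (a y₀)).comp hq).tendsto y₀
  have h2 : Filter.Tendsto (fun y => phase deg θ r (q y) (a y - a y₀)) (𝓝 y₀) (𝓝 0) := by
    refine squeeze_zero_norm (fun y => norm_phase_apply_le hr hr1 _ _) ?_
    have : Continuous fun y => ‖a y - a y₀‖ := by fun_prop
    simpa using this.tendsto y₀
  have h3 := h1.add h2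
  rw [add_zero] at h3
  refine h3.congr fun y => ?_
  rw [← map_add, add_sub_cancel]

/-- The generator `h ↦ ((aᵢ) ↦ (i θᵢ(h) r ^ deg i aᵢ))` of the phases. -/
def phaseGen {C : ℝ} (hθ : ∀ i, ‖θ i‖ ≤ C * ((deg i : ℝ) + 1) ^ 2) {r : ℝ}
    (hr : 0 ≤ r) (hr1 : r < 1) : Q →L[ℝ] (L1 ι →L[ℂ] L1 ι) :=
  LinearMap.mkContinuous
    { toFun := fun h => diag fun i => Complex.I * (θ i h : ℝ) * (r : ℂ) ^ deg i
      map_add' := fun h h' => by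
        have hB := (exists_norm_symbol_le hθ hr hr1).choose_spec.2
        rw [← diag_add (hB h) (hB h')]
        congr 1
        funext i
        simp only [map_add, Complex.ofReal_add]
        ring
      map_smul' := fun c h => by
        have hB := (exists_norm_symbol_le hθ hr hr1).choose_spec.2
        refine Eq.trans ?_ (diag_smul (c : ℂ) (hB h))
        congr 1
        funext i
        simp only [map_smul, smul_eq_mul, Complex.ofReal_mul]
        ring }
    (exists_norm_symbol_le hθ hr hr1).choose
    (fun h => norm_diag_le
      (mul_nonneg (exists_norm_symbol_le hθ hr hr1).choose_spec.1 (norm_nonneg h))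
      ((exists_norm_symbol_le hθ hr hr1).choose_spec.2 h))

/-- The weight is split as `r * s`: the factor `r ^ deg` keeps the generator `i θ` bounded, and `s ^
deg` stays with the phase. The Taylor remainder is quadratic in `θ`, hence of order `(deg + 1) ^ 4`,
and is absorbed by `(r * s) ^ deg`. -/
theorem hasFDerivAt_phase {C : ℝ} (hθ : ∀ i, ‖θ i‖ ≤ C * ((deg i : ℝ) + 1) ^ 2) {r s : ℝ}
    (hr : 0 ≤ r) (hr1 : r < 1) (hs : 0 ≤ s) (hs1 : s < 1) (q : Q) :
    HasFDerivAt (phase deg θ (r * s))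
      (((ContinuousLinearMap.mul ℝ (L1 ι →L[ℂ] L1 ι)).flip (phase deg θ s q)).comp
        (phaseGen hθ hr hr1)) q := by
  obtain ⟨B, hB0, hB⟩ := exists_succ_pow_mul_pow_le 4 (mul_nonneg hr hs)
    (mul_lt_one_of_nonneg_of_lt_one_left hr hr1 hs1.le)
  obtain ⟨D, -, hD⟩ := exists_norm_symbol_le hθ hr hr1
  have hrs : r * s ≤ 1 := mul_le_one₀ hr1.le hs hs1.le
  refine HasFDerivAt.of_isLittleO (Asymptotics.IsBigO.trans_isLittleO (g := fun q' => ‖q' - q‖ ^ 2)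
    ?_ (Asymptotics.isLittleO_pow_sub_sub q one_lt_two))
  refine Asymptotics.IsBigO.of_bound (3 * C ^ 2 * B) (Filter.Eventually.of_forall fun q' => ?_)
  have hm : ∀ i, ‖phaseSymbol deg θ (r * s) q' i - phaseSymbol deg θ (r * s) q i
      - Complex.I * (θ i (q' - q) : ℝ) * (r : ℂ) ^ deg i * phaseSymbol deg θ s q i‖
      ≤ 3 * C ^ 2 * B * ‖q' - q‖ ^ 2 := by
    intro i
    have h1 : phaseSymbol deg θ (r * s) q' i - phaseSymbol deg θ (r * s) q i
        - Complex.I * (θ i (q' - q) : ℝ) * (r : ℂ) ^ deg i * phaseSymbol deg θ s q i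
        = phaseSymbol deg θ (r * s) q i * (Complex.exp (Complex.I * (θ i (q' - q) : ℝ)) - 1
          - Complex.I * (θ i (q' - q) : ℝ)) := by
      have h2 : θ i q' = θ i q + θ i (q' - q) := by rw [← map_add, add_sub_cancel]
      simp only [phaseSymbol]
      rw [h2]
      simp only [Complex.ofReal_add, mul_add, Complex.exp_add, Complex.ofReal_mul, mul_pow]
      ring
    have h2 : (θ i (q' - q)) ^ 2 ≤ (C * ((deg i : ℝ) + 1) ^ 2 * ‖q' - q‖) ^ 2 := by
      rw [← sq_abs]
      exact pow_le_pow_left₀ (abs_nonneg _) (((θ i).le_opNorm _).trans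
        (mul_le_mul_of_nonneg_right (hθ i) (norm_nonneg _))) 2
    rw [h1, norm_mul, norm_phaseSymbol (mul_nonneg hr hs)]
    calc (r * s) ^ deg i * ‖_‖ ≤ (r * s) ^ deg i * (3 * (θ i (q' - q)) ^ 2) :=
          mul_le_mul_of_nonneg_left (norm_exp_I_sub_one_sub_le _) (by positivity)
      _ ≤ (r * s) ^ deg i * (3 * (C * ((deg i : ℝ) + 1) ^ 2 * ‖q' - q‖) ^ 2) := by gcongr
      _ = 3 * C ^ 2 * (((deg i : ℝ) + 1) ^ 4 * (r * s) ^ deg i) * ‖q' - q‖ ^ 2 := by ring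
      _ ≤ 3 * C ^ 2 * B * ‖q' - q‖ ^ 2 := by gcongr; exact hB _
  have heq : phase deg θ (r * s) q' - phase deg θ (r * s) q
      - (((ContinuousLinearMap.mul ℝ (L1 ι →L[ℂ] L1 ι)).flip (phase deg θ s q)).comp
        (phaseGen hθ hr hr1)) (q' - q)
      = diag fun i => phaseSymbol deg θ (r * s) q' i - phaseSymbol deg θ (r * s) q i
        - Complex.I * (θ i (q' - q) : ℝ) * (r : ℂ) ^ deg i * phaseSymbol deg θ s q i := by
    refine L1.clm_ext fun i => ?_
    rw [diag_unitVec hm, sub_smul, sub_smul, ← phase_unitVec (mul_nonneg hr hs) hrs,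
      ← phase_unitVec (mul_nonneg hr hs) hrs, mul_comm (_ * _), mul_smul, ← diag_unitVec (hD _) i,
      ← map_smul, ← phase_unitVec hs hs1.le]
    rfl
  rw [heq, Real.norm_of_nonneg (by positivity)]
  exact norm_diag_le (by positivity) hm

/-- With `r = √r * √r`, the derivative of the phase of weight `r` is a bounded linear expression in
the phase of weight `√r < 1`. Smoothness follows by induction on the order, over all `r < 1` at
once. -/
theorem contDiff_phase {C : ℝ} (hθ : ∀ i, ‖θ i‖ ≤ C * ((deg i : ℝ) + 1) ^ 2) {r : ℝ}
    (hr : 0 ≤ r) (hr1 : r < 1) : ContDiff ℝ ∞ (phase deg θ r) := by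
  have key : ∀ r : ℝ, 0 ≤ r → r < 1 → ∃ f' : Q → Q →L[ℝ] (L1 ι →L[ℂ] L1 ι),
      (∀ n : ℕ, (ContDiff ℝ n (phase deg θ (√r)) → ContDiff ℝ n f'))
        ∧ ∀ q, HasFDerivAt (phase deg θ r) (f' q) q := by
    intro r hr hr1
    have h1 : √r < 1 := by rwa [Real.sqrt_lt' one_pos, one_pow]
    refine ⟨fun q => ((ContinuousLinearMap.mul ℝ (L1 ι →L[ℂ] L1 ι)).flip
      (phase deg θ (√r) q)).comp (phaseGen hθ (Real.sqrt_nonneg r) h1), fun n hn => ?_, fun q => ?_⟩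
    rotate_left
    · have h := hasFDerivAt_phase hθ (Real.sqrt_nonneg r) h1 (Real.sqrt_nonneg r) h1 q
      rwa [Real.mul_self_sqrt hr] at h
    · have h2 : ContDiff ℝ n fun q =>
          (ContinuousLinearMap.mul ℝ (L1 ι →L[ℂ] L1 ι)).flip (phase deg θ (√r) q) :=
        (ContinuousLinearMap.contDiff _).comp hn
      exact h2.clm_comp contDiff_const
  rw [contDiff_infty]
  intro n
  induction n generalizing r with
  | zero =>
    obtain ⟨f', -, hf'⟩ := key r hr hr1
    exact contDiff_zero.2 (continuous_iff_continuousAt.2 fun q => (hf' q).continuousAt)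
  | succ n ih =>
    obtain ⟨f', hn, hf'⟩ := key r hr hr1
    exact contDiff_succ_iff_hasFDerivAt.2 ⟨f', hn n (ih (Real.sqrt_nonneg r)
      (by rwa [Real.sqrt_lt' one_pos, one_pow])), hf'⟩

end Phase

/-- A quantitative Picard-Lindelöf theorem: the solution together with its first Picard iterate. -/
theorem exists_ode_solution {E : Type*} [NormedAddCommGroup E] [NormedSpace ℝ E] [CompleteSpace E]
    {G : ℝ → E → E} {x₀ : E} {R B L τ : ℝ} (hR : 0 ≤ R) (hB : 0 ≤ B) (hL : 0 ≤ L) (hτ : 0 < τ)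
    (hcont : ∀ x, Continuous fun t => G t x)
    (hbound : ∀ t, ∀ x ∈ Metric.closedBall x₀ R, ‖G t x‖ ≤ B)
    (hlip : ∀ t, ∀ x ∈ Metric.closedBall x₀ R, ∀ y ∈ Metric.closedBall x₀ R,
      ‖G t x - G t y‖ ≤ L * ‖x - y‖)
    (hBτ : B * τ ≤ R) :
    ∃ a : ℝ → E, a 0 = x₀ ∧ (∀ t ∈ Set.Ioo (-τ) τ, HasDerivAt a (G t (a t)) t) ∧
      ∀ t ∈ Set.Ico 0 τ, ‖a t - x₀ - ∫ u in (0 : ℝ)..t, G u x₀‖ ≤ L * B * t ^ 2 := by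
  lift R to ℝ≥0 using hR
  lift B to ℝ≥0 using hB
  lift L to ℝ≥0 using hL
  have h0 : (0 : ℝ) ∈ Set.Icc (-τ) τ := ⟨by linarith, hτ.le⟩
  have hpl : IsPicardLindelof G (tmin := -τ) (tmax := τ) ⟨0, h0⟩ x₀ R 0 B L := by
    refine ⟨fun t _ => LipschitzOnWith.of_dist_le_mul fun x hx y hy => ?_,
      fun x _ => (hcont x).continuousOn, fun t _ x hx => hbound t x hx, ?_⟩
    · rw [dist_eq_norm, dist_eq_norm]
      exact hlip t x hx y hy
    · simpa using hBτ
  obtain ⟨α, hα⟩ := ODE.FunSpace.exists_isFixedPt_next hpl (Metric.mem_closedBall_self le_rfl)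
  -- The fixed point is extended by constants outside `[-τ, τ]`, so that it is continuous and stays
  -- in the ball at all times.
  set a : ℝ → E := α.compProj with ha
  have hmem : ∀ t, a t ∈ Metric.closedBall x₀ R := fun t =>
    α.compProj_mem_closedBall hpl.mul_max_le
  have hacont : Continuous a := α.continuous_compProj
  have hpic : ∀ t ∈ Set.Icc (-τ) τ, a t = ODE.picard G 0 x₀ a t := by
    intro t ht
    have h := ODE.FunSpace.next_apply hpl (Metric.mem_closedBall_self le_rfl) α (t := ⟨t, ht⟩)
    rw [hα.eq] at h
    rw [ha, ODE.FunSpace.compProj_apply, Set.projIcc_of_mem _ ht]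
    exact h
  have hGcont : ContinuousOn (Function.uncurry G) (Set.univ ×ˢ Metric.closedBall x₀ R) := by
    refine continuousOn_prod_of_continuousOn_lipschitzOnWith' _ L (fun t _ => ?_)
      (fun x _ => (hcont x).continuousOn)
    refine LipschitzOnWith.of_dist_le_mul fun x hx y hy => ?_
    rw [dist_eq_norm, dist_eq_norm]
    exact hlip t x hx y hy
  have hGa : Continuous fun t => G t (a t) := by
    rw [← continuousOn_univ]
    exact hGcont.comp (f := fun t => (t, a t)) (by fun_prop) fun t _ => ⟨trivial, hmem t⟩
  have ha0 : a 0 = x₀ := by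
    rw [hpic 0 h0, ODE.picard_apply₀]
  have hdist : ∀ t ∈ Set.Icc (-τ) τ, ‖a t - x₀‖ ≤ B * |t| := by
    intro t ht
    rw [hpic t ht, ODE.picard_apply, add_sub_cancel_left]
    have h := intervalIntegral.norm_integral_le_of_norm_le_const (a := 0) (b := t)
      (f := fun u => G u (a u)) (C := B) fun u _ => hbound u _ (hmem u)
    simpa using h
  refine ⟨a, ha0, fun t ht => ?_, fun t ht => ?_⟩
  · have h1 : HasDerivAt (fun t => x₀ + ∫ u in (0 : ℝ)..t, G u (a u)) (G t (a t)) t :=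
      (hGa.integral_hasStrictDerivAt 0 t).hasDerivAt.const_add x₀
    refine h1.congr_of_eventuallyEq ?_
    filter_upwards [Ioo_mem_nhds ht.1 ht.2] with u hu
    exact hpic u ⟨hu.1.le, hu.2.le⟩
  · have ht' : t ∈ Set.Icc (-τ) τ := ⟨by linarith [ht.1], ht.2.le⟩
    rw [hpic t ht', ODE.picard_apply, add_sub_cancel_left, ← intervalIntegral.integral_sub
      (hGa.intervalIntegrable _ _) ((hcont x₀).intervalIntegrable _ _)]
    -- The error is the integral of `G u (a u) - G u x₀`, which is at most `L` times the
    -- displacement `B t`.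
    have h := intervalIntegral.norm_integral_le_of_norm_le_const (a := 0) (b := t)
      (f := fun u => G u (a u) - G u x₀) (C := L * (B * t)) fun u hu => ?_
    · refine h.trans (le_of_eq ?_)
      rw [sub_zero, abs_of_nonneg ht.1]
      ring
    · rw [Set.uIoc_of_le ht.1] at hu
      have hu' : u ∈ Set.Icc (-τ) τ := ⟨by linarith [hu.1], by linarith [hu.2, ht.2]⟩
      refine (hlip u _ (hmem u) _ (Metric.mem_closedBall_self R.2)).trans ?_
      have h2 := hdist u hu'
      rw [abs_of_pos hu.1] at h2
      gcongr
      exact h2.trans (by gcongr; exact hu.2)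

/-! ### Convolution on `ℓ¹` of an additive monoid. -/

section Convolution
variable {ι : Type*} [DecidableEq ι]

theorem norm_l1Lift_unitVec_le {κ : Type*} (f : κ → ι) : ‖l1Lift fun j => unitVec (f j)‖ ≤ 1 :=
  norm_l1Lift_le zero_le_one fun j => (norm_unitVec (f j)).le

theorem L1.bilin_ext {E : Type*} [NormedAddCommGroup E] [NormedSpace ℂ E]
    {F G : L1 ι →L[ℂ] L1 ι →L[ℂ] E}
    (h : ∀ i j, F (unitVec i) (unitVec j) = G (unitVec i) (unitVec j)) : F = G :=
  L1.clm_ext fun i => L1.clm_ext fun j => h i j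

variable [AddMonoid ι]

/-- Convolution on `ℓ¹(ι)`. -/
def conv : L1 ι →L[ℂ] L1 ι →L[ℂ] L1 ι := l1Lift fun i => l1Lift fun j => unitVec (i + j)

@[simp] theorem conv_unitVec (i j : ι) : conv (unitVec i) (unitVec j) = unitVec (i + j) := by
  rw [conv, l1Lift_unitVec fun i => norm_l1Lift_unitVec_le _,
    l1Lift_unitVec fun j => (norm_unitVec _).le]

theorem norm_conv_le (a b : L1 ι) : ‖conv a b‖ ≤ ‖a‖ * ‖b‖ := by
  have h : ‖(conv : L1 ι →L[ℂ] L1 ι →L[ℂ] L1 ι)‖ ≤ 1 :=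
    norm_l1Lift_le zero_le_one fun i => norm_l1Lift_unitVec_le _
  refine (ContinuousLinearMap.le_opNorm₂ _ a b).trans ?_
  rw [mul_assoc]
  exact mul_le_of_le_one_left (by positivity) h

theorem contDiff_conv {Y : Type*} [NormedAddCommGroup Y] [NormedSpace ℝ Y] {f g : Y → L1 ι}
    {n : WithTop ℕ∞} (hf : ContDiff ℝ n f) (hg : ContDiff ℝ n g) :
    ContDiff ℝ n fun y => conv (f y) (g y) := by
  have h : IsBoundedBilinearMap ℝ fun p : L1 ι × L1 ι => conv p.1 p.2 :=
    { add_left := fun a b c => by simp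
      smul_left := fun c a b => by
        have := congrArg (fun T => T b) (conv.map_smul (c : ℂ) a)
        exact this
      add_right := fun a b c => by simp
      smul_right := fun c a b => (conv a).map_smul (c : ℂ) b
      bound := ⟨1, one_pos, fun a b => by simpa using norm_conv_le a b⟩ }
  exact h.contDiff.comp (hf.prodMk hg)

/-- Bounded characters of the index monoid act by algebra homomorphisms. It is applied to the degree
weights; the scalar version `l1Lift_conv` serves for evaluation at a point. -/
theorem diag_conv {χ : ι → ℂ} {C : ℝ} (hC : ∀ i, ‖χ i‖ ≤ C)
    (hχ : ∀ i j, χ (i + j) = χ i * χ j) (a b : L1 ι) :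
    diag χ (conv a b) = conv (diag χ a) (diag χ b) := by
  have h : (ContinuousLinearMap.compL ℂ (L1 ι) (L1 ι) (L1 ι) (diag χ)).comp conv
      = conv.bilinearComp (diag χ) (diag χ) := by
    refine L1.bilin_ext fun i j => ?_
    change diag χ (conv (unitVec i) (unitVec j)) = conv (diag χ (unitVec i)) (diag χ (unitVec j))
    rw [conv_unitVec, diag_unitVec hC, diag_unitVec hC, diag_unitVec hC, map_smul,
      map_smul, smul_apply, conv_unitVec, smul_smul, hχ, mul_comm]
  exact DFunLike.congr_fun (DFunLike.congr_fun h a) b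

theorem l1Lift_conv {χ : ι → ℂ} {C : ℝ} (hC : ∀ i, ‖χ i‖ ≤ C)
    (hχ : ∀ i j, χ (i + j) = χ i * χ j) (a b : L1 ι) :
    l1Lift χ (conv a b) = l1Lift χ a * l1Lift χ b := by
  have h : (ContinuousLinearMap.compL ℂ (L1 ι) (L1 ι) ℂ (l1Lift χ)).comp conv
      = (ContinuousLinearMap.mul ℂ ℂ).bilinearComp (l1Lift χ) (l1Lift χ) := by
    refine L1.bilin_ext fun i j => ?_
    change l1Lift χ (conv (unitVec i) (unitVec j)) = l1Lift χ (unitVec i) * l1Lift χ (unitVec j)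
    rw [conv_unitVec, l1Lift_unitVec hC, l1Lift_unitVec hC, l1Lift_unitVec hC, hχ]
  exact DFunLike.congr_fun (DFunLike.congr_fun h a) b

end Convolution

/-! ### Complex conjugation on the Fourier side. -/

section Conj
variable {ι : Type*} [DecidableEq ι]

/-- The antilinear map on `ℓ¹(ι)` sending the unit vector `i` to the unit vector `τ i`. -/
def conjMap (τ : ι → ι) : L1 ι →L[ℝ] L1 ι :=
  ((l1Lift fun i => unitVec (τ i)).restrictScalars ℝ).comp
    (starL' ℝ : L1 ι ≃L[ℝ] L1 ι).toContinuousLinearMap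

theorem conjMap_apply (τ : ι → ι) (a : L1 ι) :
    conjMap τ a = l1Lift (fun i => unitVec (τ i)) (star a) := rfl

theorem star_unitVec (i : ι) : star (unitVec i) = unitVec i := by
  refine lp.ext (funext fun j => ?_)
  rw [lp.star_apply, unitVec_apply]
  split_ifs <;> simp

theorem conjMap_smul_unitVec (τ : ι → ι) (c : ℂ) (i : ι) :
    conjMap τ (c • unitVec i) = (starRingEnd ℂ) c • unitVec (τ i) := by
  rw [conjMap_apply, star_smul, star_unitVec, map_smul,
    l1Lift_unitVec fun j => (norm_unitVec _).le]
  rfl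

theorem norm_conjMap_le (τ : ι → ι) (a : L1 ι) : ‖conjMap τ a‖ ≤ ‖a‖ := by
  have h := norm_l1Lift_apply_le (fun j => (norm_unitVec (τ j)).le) (star a)
  rwa [one_mul, norm_star] at h

theorem l1Lift_conjMap {χ : ι → ℂ} {C : ℝ} (hC : ∀ i, ‖χ i‖ ≤ C) {τ : ι → ι}
    (hχ : ∀ i, χ (τ i) = (starRingEnd ℂ) (χ i)) (a : L1 ι) :
    l1Lift χ (conjMap τ a) = (starRingEnd ℂ) (l1Lift χ a) := by
  have hC' : ∀ i, ‖χ (τ i)‖ ≤ C := fun i => hC _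
  have h1 : (l1Lift χ).comp (l1Lift fun i => unitVec (τ i)) = l1Lift fun i => χ (τ i) := by
    refine L1.clm_ext fun i => ?_
    rw [ContinuousLinearMap.comp_apply, l1Lift_unitVec fun j => (norm_unitVec _).le,
      l1Lift_unitVec hC, l1Lift_unitVec hC']
  have h2 := DFunLike.congr_fun h1 (star a)
  rw [ContinuousLinearMap.comp_apply] at h2
  rw [conjMap_apply, h2, l1Lift_apply hC', l1Lift_apply hC, Complex.conj_tsum]
  refine tsum_congr fun i => ?_
  rw [hχ, smul_eq_mul, smul_eq_mul, map_mul]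
  rfl

theorem diag_conjMap {m : ι → ℂ} {C : ℝ} (hm : ∀ i, ‖m i‖ ≤ C) {τ : ι → ι}
    (hmτ : ∀ i, m (τ i) = (starRingEnd ℂ) (m i)) (a : L1 ι) :
    diag m (conjMap τ a) = conjMap τ (diag m a) := by
  have hm' : ∀ i, ‖(starRingEnd ℂ) (m i)‖ ≤ C := fun i => by simpa using hm i
  have h1 : (diag m).comp (l1Lift fun i => unitVec (τ i))
      = (l1Lift fun i => unitVec (τ i)).comp (diag fun i => (starRingEnd ℂ) (m i)) := by
    refine L1.clm_ext fun i => ?_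
    rw [ContinuousLinearMap.comp_apply, ContinuousLinearMap.comp_apply, diag_unitVec hm', map_smul,
      l1Lift_unitVec fun j => (norm_unitVec _).le, diag_unitVec hm, hmτ]
  have h2 : diag (fun i => (starRingEnd ℂ) (m i)) (star a) = star (diag m a) := by
    refine lp.ext (funext fun j => ?_)
    rw [lp.star_apply, diag_apply hm, diag_apply hm', lp.star_apply]
    simp
  rw [conjMap_apply, conjMap_apply, ← h2]
  exact DFunLike.congr_fun h1 (star a)

end Conj

/-! ### The power and mass nonlinearities, and their compatibility with the grading. -/

section Nonlinearity
variable {ι : Type*}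

theorem norm_pow_deg_le (deg : ι → ℕ) {r : ℝ} (hr : 0 ≤ r) (hr1 : r ≤ 1) (i : ι) :
    ‖(r : ℂ) ^ deg i‖ ≤ 1 := by
  rw [norm_pow, Complex.norm_real, Real.norm_of_nonneg hr]
  exact pow_le_one₀ hr hr1

variable [DecidableEq ι]

/-- The operator `(aᵢ) ↦ (r ^ deg i * aᵢ)`. -/
def degScale (deg : ι → ℕ) (r : ℝ) : L1 ι →L[ℂ] L1 ι := diag fun i => (r : ℂ) ^ deg i

/-- The properties of a nonlinearity of order `2σ + 1` on a graded `ℓ¹` that are used to solve the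
equation. -/
structure IsAdmissible (deg : ι → ℕ) (σ : ℕ) (C : ℝ) (F : L1 ι → L1 ι) : Prop where
  map_zero : F 0 = 0
  lipschitz : ∀ (R : ℝ) (u v : L1 ι), ‖u‖ ≤ R → ‖v‖ ≤ R →
    ‖F u - F v‖ ≤ C * R ^ (2 * σ) * ‖u - v‖
  contDiff : ContDiff ℝ ∞ F
  map_degScale : ∀ r : ℝ, 0 ≤ r → r ≤ 1 → ∀ u, F (degScale deg r u) = degScale deg r (F u)

theorem IsAdmissible.norm_le {deg : ι → ℕ} {σ : ℕ} {C : ℝ} {F : L1 ι → L1 ι}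
    (hF : IsAdmissible deg σ C F) {R : ℝ} {u : L1 ι} (hu : ‖u‖ ≤ R) :
    ‖F u‖ ≤ C * R ^ (2 * σ) * ‖u‖ := by
  have h := hF.lipschitz R u 0 hu (by rw [norm_zero]; exact (norm_nonneg u).trans hu)
  rwa [hF.map_zero, sub_zero, sub_zero] at h

theorem IsAdmissible.smul {deg : ι → ℕ} {σ : ℕ} {C : ℝ} {F : L1 ι → L1 ι}
    (hF : IsAdmissible deg σ C F) (c : ℂ) : IsAdmissible deg σ (‖c‖ * C) fun u => c • F u where
  map_zero := by rw [hF.map_zero, smul_zero]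
  lipschitz R u v hu hv := by
    rw [← smul_sub, norm_smul, mul_assoc, mul_assoc, ← mul_assoc C]
    exact mul_le_mul_of_nonneg_left (hF.lipschitz R u v hu hv) (norm_nonneg c)
  contDiff := hF.contDiff.const_smul c
  map_degScale r hr hr1 u := by rw [hF.map_degScale r hr hr1, map_smul]

theorem IsAdmissible.add {deg : ι → ℕ} {σ : ℕ} {C C' : ℝ} {F G : L1 ι → L1 ι}
    (hF : IsAdmissible deg σ C F) (hG : IsAdmissible deg σ C' G) :
    IsAdmissible deg σ (C + C') fun u => F u + G u where
  map_zero := by rw [hF.map_zero, hG.map_zero, add_zero]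
  lipschitz R u v hu hv := by
    rw [add_sub_add_comm, add_mul, add_mul]
    exact (norm_add_le _ _).trans (add_le_add (hF.lipschitz R u v hu hv) (hG.lipschitz R u v hu hv))
  contDiff := hF.contDiff.add hG.contDiff
  map_degScale r hr hr1 u := by rw [hF.map_degScale r hr hr1, hG.map_degScale r hr hr1, map_add]

variable [AddMonoid ι]

theorem degScale_conv {deg : ι → ℕ} (hdeg : ∀ i j, deg (i + j) = deg i + deg j) {r : ℝ}
    (hr : 0 ≤ r) (hr1 : r ≤ 1) (a b : L1 ι) :
    degScale deg r (conv a b) = conv (degScale deg r a) (degScale deg r b) :=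
  diag_conv (norm_pow_deg_le deg hr hr1) (fun i j => by rw [hdeg, pow_add]) a b

theorem norm_conv_sub_conv_le {R M L : ℝ} {u v x y : L1 ι} (hv : ‖v‖ ≤ R) (hx : ‖x‖ ≤ M)
    (hxy : ‖x - y‖ ≤ L * ‖u - v‖) :
    ‖conv u x - conv v y‖ ≤ (M + R * L) * ‖u - v‖ := by
  have h : conv u x - conv v y = conv (u - v) x + conv v (x - y) := by
    simp
  rw [h]
  refine (norm_add_le _ _).trans ?_
  have h1 : ‖conv (u - v) x‖ ≤ ‖u - v‖ * M :=
    (norm_conv_le _ _).trans (mul_le_mul_of_nonneg_left hx (norm_nonneg _))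
  have h2 : ‖conv v (x - y)‖ ≤ R * (L * ‖u - v‖) :=
    (norm_conv_le _ _).trans (mul_le_mul hv hxy (norm_nonneg _) ((norm_nonneg _).trans hv))
  linarith

/-- The nonlinearity `|u|^{2n} u` on the Fourier side. -/
def oddPower (τ : ι → ι) : ℕ → L1 ι → L1 ι
  | 0, u => u
  | n + 1, u => conv u (conv (conjMap τ u) (oddPower τ n u))

theorem norm_oddPower_le (τ : ι → ι) (n : ℕ) (u : L1 ι) : ‖oddPower τ n u‖ ≤ ‖u‖ ^ (2 * n + 1) := by
  induction n with
  | zero => simp [oddPower]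
  | succ n ih =>
    rw [oddPower]
    calc _ ≤ ‖u‖ * (‖u‖ * ‖u‖ ^ (2 * n + 1)) :=
          (norm_conv_le _ _).trans (mul_le_mul_of_nonneg_left ((norm_conv_le _ _).trans
            (mul_le_mul (norm_conjMap_le τ u) ih (norm_nonneg _) (norm_nonneg _))) (norm_nonneg _))
      _ = ‖u‖ ^ (2 * (n + 1) + 1) := by ring

/-- The product is telescoped, changing one of its `2n + 1` factors at a time. -/
theorem oddPower_lipschitz (τ : ι → ι) (n : ℕ) {R : ℝ} {u v : L1 ι} (hu : ‖u‖ ≤ R) (hv : ‖v‖ ≤ R) :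
    ‖oddPower τ n u - oddPower τ n v‖ ≤ (2 * n + 1) * R ^ (2 * n) * ‖u - v‖ := by
  have hR : 0 ≤ R := (norm_nonneg u).trans hu
  induction n with
  | zero => simp [oddPower]
  | succ n ih =>
    have hP : ‖oddPower τ n u‖ ≤ R ^ (2 * n + 1) :=
      (norm_oddPower_le τ n u).trans (pow_le_pow_left₀ (norm_nonneg _) hu _)
    have hc : ‖conjMap τ u - conjMap τ v‖ ≤ ‖u - v‖ := by
      rw [← map_sub]
      exact norm_conjMap_le τ _
    have h1 : ‖conv (conjMap τ u) (oddPower τ n u) - conv (conjMap τ v) (oddPower τ n v)‖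
        ≤ (R ^ (2 * n + 1) + R * ((2 * n + 1) * R ^ (2 * n))) * ‖u - v‖ := by
      have h : conv (conjMap τ u) (oddPower τ n u) - conv (conjMap τ v) (oddPower τ n v)
          = conv (conjMap τ u - conjMap τ v) (oddPower τ n u)
            + conv (conjMap τ v) (oddPower τ n u - oddPower τ n v) := by simp
      rw [h]
      refine (norm_add_le _ _).trans ?_
      have h1 := (norm_conv_le (conjMap τ u - conjMap τ v) (oddPower τ n u)).trans
        (mul_le_mul hc hP (norm_nonneg _) (norm_nonneg _))
      have h2 := (norm_conv_le (conjMap τ v) (oddPower τ n u - oddPower τ n v)).trans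
        (mul_le_mul ((norm_conjMap_le τ v).trans hv) ih (norm_nonneg _) hR)
      linarith
    have h2 : ‖conv (conjMap τ u) (oddPower τ n u)‖ ≤ R * R ^ (2 * n + 1) :=
      (norm_conv_le _ _).trans (mul_le_mul ((norm_conjMap_le τ u).trans hu) hP (norm_nonneg _) hR)
    refine (norm_conv_sub_conv_le hv h2 h1).trans (le_of_eq ?_)
    push_cast
    ring

theorem oddPower_isAdmissible {deg : ι → ℕ} (hdeg : ∀ i j, deg (i + j) = deg i + deg j)
    {τ : ι → ι} (hτ : ∀ i, deg (τ i) = deg i) (n : ℕ) :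
    IsAdmissible deg n (2 * n + 1) (oddPower τ n) where
  map_zero := by
    have h := norm_oddPower_le τ n 0
    simpa using h
  lipschitz R u v hu hv := oddPower_lipschitz τ n hu hv
  contDiff := by
    induction n with
    | zero => exact contDiff_id
    | succ n ih => exact contDiff_conv contDiff_id (contDiff_conv (conjMap τ).contDiff ih)
  map_degScale r hr hr1 u := by
    induction n with
    | zero => rfl
    | succ n ih =>
      rw [oddPower, oddPower, degScale_conv hdeg hr hr1, degScale_conv hdeg hr hr1, ← ih]
      congr 3
      refine (diag_conjMap (norm_pow_deg_le deg hr hr1) (fun i => ?_) u).symm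
      simp [hτ]

/-- The term `(∫ |u|²) u` on the Fourier side, where `m` restricts to the zero frequency. -/
def massTerm (τ : ι → ι) (m : ι → ℂ) (u : L1 ι) : L1 ι := conv (diag m (conv u (conjMap τ u))) u

theorem massTerm_isAdmissible {deg : ι → ℕ} (hdeg : ∀ i j, deg (i + j) = deg i + deg j)
    {τ : ι → ι} (hτ : ∀ i, deg (τ i) = deg i) {m : ι → ℂ} (hm : ∀ i, ‖m i‖ ≤ 1) :
    IsAdmissible deg 1 3 (massTerm τ m) where
  map_zero := by simp [massTerm]
  lipschitz R u v hu hv := by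
    have hR : 0 ≤ R := (norm_nonneg u).trans hu
    have h : massTerm τ m u - massTerm τ m v
        = conv (diag m (conv u (conjMap τ u))) (u - v)
          + conv (diag m (conv (u - v) (conjMap τ u))) v
          + conv (diag m (conv v (conjMap τ (u - v)))) v := by
      simp [massTerm]
    have hb : ∀ a b c : L1 ι, ‖conv (diag m (conv a (conjMap τ b))) c‖ ≤ ‖a‖ * ‖b‖ * ‖c‖ := by
      intro a b c
      refine (norm_conv_le _ _).trans (mul_le_mul_of_nonneg_right ?_ (norm_nonneg _))
      refine (norm_diag_apply_le hm _).trans ?_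
      rw [one_mul]
      exact (norm_conv_le _ _).trans
        (mul_le_mul_of_nonneg_left (norm_conjMap_le τ b) (norm_nonneg _))
    rw [h]
    have h1 := (hb u u (u - v)).trans (mul_le_mul_of_nonneg_right
      (mul_le_mul hu hu (norm_nonneg _) hR) (norm_nonneg _))
    have h2 := (hb (u - v) u v).trans (mul_le_mul (mul_le_mul_of_nonneg_left hu (norm_nonneg _)) hv
      (norm_nonneg _) (by positivity))
    have h3 := (hb v (u - v) v).trans (mul_le_mul (mul_le_mul_of_nonneg_right hv (norm_nonneg _)) hv
      (norm_nonneg _) (by positivity))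
    refine (norm_add₃_le).trans ?_
    rw [mul_one]
    linarith
  contDiff := by
    refine contDiff_conv ?_ contDiff_id
    exact ((diag m).restrictScalars ℝ).contDiff.comp (contDiff_conv contDiff_id (conjMap τ).contDiff)
  map_degScale r hr hr1 u := by
    have h1 : ∀ a, diag m (degScale deg r a) = degScale deg r (diag m a) := by
      intro a
      have h := norm_pow_deg_le deg hr hr1
      rw [degScale, ← ContinuousLinearMap.comp_apply, ← ContinuousLinearMap.comp_apply,
        diag_comp hm h, diag_comp h hm]
      simp_rw [mul_comm]
    have h2 : conjMap τ (degScale deg r u) = degScale deg r (conjMap τ u) :=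
      (diag_conjMap (norm_pow_deg_le deg hr hr1) (fun i => by simp [hτ]) u).symm
    rw [massTerm, massTerm, degScale_conv hdeg hr hr1, h2, ← degScale_conv hdeg hr hr1, h1]

end Nonlinearity

/-! ### The equation in the interaction picture, and smoothness in time. -/

section Flow
variable {ι : Type*}

theorem isBoundedBilinearMap_clmApply :
    IsBoundedBilinearMap ℝ fun p : (L1 ι →L[ℂ] L1 ι) × L1 ι => p.1 p.2 where
  add_left _ _ _ := rfl
  smul_left _ _ _ := rfl
  add_right T a b := map_add T a b
  smul_right c T a := T.map_smul (c : ℂ) a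
  bound := ⟨1, one_pos, fun T a => by simpa using T.le_opNorm a⟩

variable {Q : Type*} [NormedAddCommGroup Q] [NormedSpace ℝ Q]
  {deg : ι → ℕ} {θ : ι → Q →L[ℝ] ℝ}

theorem norm_linear_phaseSymbol_le {D : ℝ} (hθ : ∀ i, ‖θ i‖ ≤ D * ((deg i : ℝ) + 1) ^ 2) {r : ℝ}
    (hr : 0 ≤ r) (hr1 : r < 1) (v : Q) :
    ∃ B : ℝ, ∀ q i, ‖Complex.I * (θ i v : ℝ) * phaseSymbol deg θ r q i‖ ≤ B := by
  obtain ⟨B, -, hB⟩ := exists_norm_symbol_le hθ hr hr1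
  refine ⟨B * ‖v‖, fun q i => ?_⟩
  refine le_trans (le_of_eq ?_) (hB v i)
  rw [norm_mul, norm_phaseSymbol hr, norm_mul _ ((r : ℂ) ^ _), norm_pow, Complex.norm_real r,
    Real.norm_of_nonneg hr]

theorem norm_quadratic_phaseSymbol_le {D : ℝ} (hθ : ∀ i, ‖θ i‖ ≤ D * ((deg i : ℝ) + 1) ^ 2)
    {r : ℝ} (hr : 0 ≤ r) (hr1 : r < 1) (v : Q) :
    ∃ B : ℝ, ∀ q i, ‖-(θ i v : ℂ) ^ 2 * phaseSymbol deg θ r q i‖ ≤ B := by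
  obtain ⟨B, hB0, hB⟩ := exists_succ_pow_mul_pow_le 4 hr hr1
  refine ⟨(D * ‖v‖) ^ 2 * B, fun q i => ?_⟩
  have h : (θ i v) ^ 2 ≤ (D * ((deg i : ℝ) + 1) ^ 2 * ‖v‖) ^ 2 := by
    rw [← sq_abs]
    exact pow_le_pow_left₀ (abs_nonneg _) (((θ i).le_opNorm _).trans
      (mul_le_mul_of_nonneg_right (hθ i) (norm_nonneg _))) 2
  rw [norm_mul, norm_phaseSymbol hr, norm_neg, norm_pow, Complex.norm_real, Real.norm_eq_abs,
    sq_abs]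
  calc (θ i v) ^ 2 * r ^ deg i ≤ (D * ((deg i : ℝ) + 1) ^ 2 * ‖v‖) ^ 2 * r ^ deg i := by gcongr
    _ = (D * ‖v‖) ^ 2 * (((deg i : ℝ) + 1) ^ 4 * r ^ deg i) := by ring
    _ ≤ (D * ‖v‖) ^ 2 * B := by gcongr; exact hB _

variable [DecidableEq ι]

theorem degScale_eq_phase (r : ℝ) : degScale deg r = phase deg θ r 0 := by
  rw [degScale, phase]
  congr 1
  funext i
  simp [phaseSymbol]

theorem phase_comp_degScale {r s : ℝ} (hr : 0 ≤ r) (hr1 : r ≤ 1) (hs : 0 ≤ s) (hs1 : s ≤ 1)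
    (q : Q) (a : L1 ι) : phase deg θ r q (degScale deg s a) = phase deg θ (r * s) q a := by
  rw [degScale_eq_phase (θ := θ), phase_phase hr hr1 hs hs1, add_zero]

theorem degScale_phase {r s : ℝ} (hr : 0 ≤ r) (hr1 : r ≤ 1) (hs : 0 ≤ s) (hs1 : s ≤ 1)
    (q : Q) (a : L1 ι) : degScale deg r (phase deg θ s q a) = phase deg θ (r * s) q a := by
  rw [degScale_eq_phase (θ := θ), phase_phase hr hr1 hs hs1, zero_add]

variable (deg θ) in
/-- The vector field of the equation in the interaction picture, for the linear flow
`t ↦ phase (t • e)`. -/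
def interaction (e : Q) (F : L1 ι → L1 ι) (t : ℝ) (a : L1 ι) : L1 ι :=
  -Complex.I • phase deg θ 1 (-t • e) (F (phase deg θ 1 (t • e) a))

theorem continuous_interaction {σ : ℕ} {C : ℝ} {F : L1 ι → L1 ι}
    (hF : IsAdmissible deg σ C F) (e : Q) (x : L1 ι) :
    Continuous fun t => interaction deg θ e F t x := by
  have h1 : Continuous fun t : ℝ => phase deg θ 1 (t • e) x :=
    continuous_phase_apply_of_continuous zero_le_one le_rfl (by fun_prop) continuous_const
  have h2 : Continuous fun t : ℝ => phase deg θ 1 (-t • e) (F (phase deg θ 1 (t • e) x)) :=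
    continuous_phase_apply_of_continuous zero_le_one le_rfl (by fun_prop)
      (hF.contDiff.continuous.comp h1)
  exact h2.const_smul (-Complex.I)

/-- The phases do not increase the norm, so on the ball of radius `ρ` around `x₀` the field inherits
the bounds of `F` at radius `2ρ`: size `B = C (2ρ)^{2σ+1}` and Lipschitz constant `L = C (2ρ)^{2σ}`.
The condition on `τ` is `B τ ≤ ρ`, and the error constant is `L B`. -/
theorem exists_interaction_solution {σ : ℕ} {C : ℝ} {F : L1 ι → L1 ι}
    (hF : IsAdmissible deg σ C F) (hC : 0 < C) (e : Q) {x₀ : L1 ι} {ρ τ : ℝ} (hρ : 0 < ρ)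
    (hx₀ : ‖x₀‖ ≤ ρ) (hτ : 0 < τ) (hτρ : C * 2 ^ (2 * σ + 1) * ρ ^ (2 * σ) * τ ≤ 1) :
    ∃ a : ℝ → L1 ι, a 0 = x₀ ∧
      (∀ t ∈ Set.Ioo (-τ) τ, HasDerivAt a (interaction deg θ e F t (a t)) t) ∧
      ∀ t ∈ Set.Ico 0 τ, ‖a t - x₀ - ∫ u in (0 : ℝ)..t, interaction deg θ e F u x₀‖
        ≤ C ^ 2 * (2 * ρ) ^ (4 * σ + 1) * t ^ 2 := by
  have hball : ∀ x ∈ Metric.closedBall x₀ ρ, ∀ t : ℝ, ‖phase deg θ 1 (t • e) x‖ ≤ 2 * ρ := by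
    intro x hx t
    refine (norm_phase_apply_le zero_le_one le_rfl _ _).trans ?_
    rw [mem_closedBall_iff_norm] at hx
    have := norm_le_norm_add_norm_sub' x x₀
    linarith
  have hnorm_phase : ∀ (t : ℝ) (x : L1 ι), ‖-Complex.I • phase deg θ 1 (-t • e) x‖ ≤ ‖x‖ := by
    intro t x
    rw [norm_smul, norm_neg, Complex.norm_I, one_mul]
    exact norm_phase_apply_le zero_le_one le_rfl _ _
  have h := exists_ode_solution (G := interaction deg θ e F) (x₀ := x₀) (R := ρ)
    (B := C * (2 * ρ) ^ (2 * σ) * (2 * ρ)) (L := C * (2 * ρ) ^ (2 * σ)) (τ := τ) hρ.le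
    (by positivity) (by positivity) hτ ?_ ?_ ?_ ?_
  · obtain ⟨a, h0, h1, h2⟩ := h
    refine ⟨a, h0, h1, fun t ht => (h2 t ht).trans (le_of_eq ?_)⟩
    generalize 2 * ρ = R
    ring
  · exact continuous_interaction hF e
  · intro t x hx
    exact (hnorm_phase t _).trans ((hF.norm_le (hball x hx t)).trans
      (mul_le_mul_of_nonneg_left (hball x hx t) (by positivity)))
  · intro t x hx y hy
    rw [interaction, interaction, ← smul_sub, ← map_sub]
    refine (hnorm_phase t _).trans ((hF.lipschitz _ _ _ (hball x hx t) (hball y hy t)).trans ?_)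
    rw [← map_sub]
    exact mul_le_mul_of_nonneg_left (norm_phase_apply_le zero_le_one le_rfl _ _) (by positivity)
  · calc C * (2 * ρ) ^ (2 * σ) * (2 * ρ) * τ
        = C * 2 ^ (2 * σ + 1) * ρ ^ (2 * σ) * τ * ρ := by rw [mul_pow]; ring
      _ ≤ 1 * ρ := mul_le_mul_of_nonneg_right hτρ hρ.le
      _ = ρ := one_mul ρ

/-- Of the weight `p⁴`, a factor `p²` damps the outer phase. The other `p²` passes through `F` and
is shared between the inner phase and `a`. -/
theorem degScale_interaction {σ : ℕ} {C : ℝ} {F : L1 ι → L1 ι} (hF : IsAdmissible deg σ C F)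
    (e : Q) {p : ℝ} (hp : 0 ≤ p) (hp1 : p ≤ 1) (t : ℝ) (a : L1 ι) :
    degScale deg (p * p * (p * p)) (interaction deg θ e F t a)
      = -Complex.I • phase deg θ (p * p) (-t • e)
        (F (phase deg θ p (t • e) (degScale deg p a))) := by
  have hpp : 0 ≤ p * p := mul_nonneg hp hp
  have hpp1 : p * p ≤ 1 := mul_le_one₀ hp1 hp hp1
  rw [phase_comp_degScale hp hp1 hp hp1, ← mul_one (p * p),
    ← degScale_phase hpp hpp1 zero_le_one le_rfl (t • e) a, mul_one,
    hF.map_degScale _ hpp hpp1, phase_comp_degScale hpp hpp1 hpp hpp1, interaction, map_smul,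
    degScale_phase (mul_nonneg hpp hpp) (mul_le_one₀ hpp1 hpp hpp1) zero_le_one le_rfl, mul_one]

/-- The undamped field is only known to be continuous in time. After damping, the time derivative is
a smooth function of `t` and of a damped copy of `a` with a weaker weight, so regularity can be
bootstrapped over all weights below `1`. -/
theorem contDiffOn_degScale {σ : ℕ} {C : ℝ} {F : L1 ι → L1 ι} (hF : IsAdmissible deg σ C F)
    {D : ℝ} (hθ : ∀ i, ‖θ i‖ ≤ D * ((deg i : ℝ) + 1) ^ 2) {e : Q} {J : Set ℝ} (hJ : IsOpen J)
    {a : ℝ → L1 ι} (ha : ∀ t ∈ J, HasDerivAt a (interaction deg θ e F t (a t)) t) {r : ℝ}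
    (hr : 0 ≤ r) (hr1 : r < 1) : ContDiffOn ℝ ∞ (fun t => degScale deg r (a t)) J := by
  have hder : ∀ r : ℝ, ∀ t ∈ J, HasDerivAt (fun t => degScale deg r (a t))
      (degScale deg r (interaction deg θ e F t (a t))) t := fun r t ht =>
    (((degScale deg r).restrictScalars ℝ).hasFDerivAt.comp_hasDerivAt t (ha t ht))
  have hdiff : ∀ r : ℝ, DifferentiableOn ℝ (fun t => degScale deg r (a t)) J := fun r t ht =>
    (hder r t ht).differentiableAt.differentiableWithinAt
  rw [contDiffOn_infty]
  intro n
  induction n generalizing r with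
  | zero => exact contDiffOn_zero.2 (hdiff r).continuousOn
  | succ n ih =>
    refine (contDiffOn_succ_iff_deriv_of_isOpen hJ).2 ⟨hdiff r,
      fun h => absurd h (WithTop.natCast_ne_top n), ?_⟩
    -- Here `p` is the fourth root of `r`, as the splitting in `degScale_interaction` requires.
    obtain ⟨p, hp, hp1, rfl⟩ : ∃ p : ℝ, 0 ≤ p ∧ p < 1 ∧ p * p * (p * p) = r := by
      refine ⟨√(√r), Real.sqrt_nonneg _, ?_, ?_⟩
      · rw [Real.sqrt_lt' one_pos, one_pow, Real.sqrt_lt' one_pos, one_pow]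
        exact hr1
      · rw [Real.mul_self_sqrt (Real.sqrt_nonneg r), Real.mul_self_sqrt hr]
    have hpp1 : p * p < 1 := mul_lt_one_of_nonneg_of_lt_one_left hp hp1 hp1.le
    have h1 : ContDiffOn ℝ n (fun t : ℝ => -Complex.I • phase deg θ (p * p) (-t • e)
        (F (phase deg θ p (t • e) (degScale deg p (a t))))) J := by
      refine ContDiffOn.const_smul _ ?_
      have hn : ((n : ℕ∞) : WithTop ℕ∞) ≤ (∞ : WithTop ℕ∞) := by exact_mod_cast le_top
      have hph : ∀ {r : ℝ}, 0 ≤ r → r < 1 → ContDiff ℝ n (phase deg θ r) := fun h h' =>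
        (contDiff_phase hθ h h').of_le hn
      refine isBoundedBilinearMap_clmApply.contDiff.comp_contDiffOn
        (ContDiffOn.prodMk (f := fun t : ℝ => phase deg θ (p * p) (-t • e)) ?_ ?_)
      · exact ((hph (mul_nonneg hp hp) hpp1).comp
          (contDiff_id.neg.smul contDiff_const)).contDiffOn
      · refine (hF.contDiff.of_le hn).comp_contDiffOn ?_
        refine isBoundedBilinearMap_clmApply.contDiff.comp_contDiffOn
          (ContDiffOn.prodMk (f := fun t : ℝ => phase deg θ p (t • e)) ?_ (ih hp hp1))
        exact ((hph hp hp1).comp (contDiff_id.smul contDiff_const)).contDiffOn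
    refine h1.congr fun t ht => ?_
    rw [(hder _ t ht).deriv, degScale_interaction hF e hp hp1.le]

theorem hasDerivAt_phase_line {D : ℝ} (hθ : ∀ i, ‖θ i‖ ≤ D * ((deg i : ℝ) + 1) ^ 2) {r : ℝ}
    (hr : 0 ≤ r) (hr1 : r < 1) (q v : Q) (y : ℝ) :
    HasDerivAt (fun y : ℝ => phase deg θ r (q + y • v))
      (diag fun i => Complex.I * (θ i v : ℝ) * phaseSymbol deg θ r (q + y • v) i) y := by
  have h1 : √r < 1 := by rwa [Real.sqrt_lt' one_pos, one_pow]
  have h0 := Real.sqrt_nonneg r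
  have h := hasFDerivAt_phase hθ h0 h1 h0 h1 (q + y • v)
  rw [Real.mul_self_sqrt hr] at h
  have hl : HasDerivAt (fun y : ℝ => q + y • v) v y := by
    simpa using ((hasDerivAt_id y).smul_const v).const_add q
  refine (h.comp_hasDerivAt y hl).congr_deriv ?_
  obtain ⟨B, -, hB⟩ := exists_norm_symbol_le hθ h0 h1
  change (diag fun i => Complex.I * (θ i v : ℝ) * ((√r : ℝ) : ℂ) ^ deg i).comp
    (diag (phaseSymbol deg θ (√r) (q + y • v))) = _
  rw [diag_comp (hB v) (norm_phaseSymbol_le h0 h1.le _)]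
  congr 1
  funext i
  have h2 : (r : ℂ) = (√r : ℝ) * (√r : ℝ) := by
    rw [← Complex.ofReal_mul, Real.mul_self_sqrt hr]
  rw [phaseSymbol, phaseSymbol, h2, mul_pow]
  ring

theorem hasDerivAt_phase_line_snd {D : ℝ} (hθ : ∀ i, ‖θ i‖ ≤ D * ((deg i : ℝ) + 1) ^ 2) {r : ℝ}
    (hr : 0 ≤ r) (hr1 : r < 1) (q v : Q) (y : ℝ) :
    HasDerivAt
      (fun y : ℝ => diag fun i => Complex.I * (θ i v : ℝ) * phaseSymbol deg θ r (q + y • v) i)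
      (diag fun i => -(θ i v : ℂ) ^ 2 * phaseSymbol deg θ r (q + y • v) i) y := by
  have h1 : √r < 1 := by rwa [Real.sqrt_lt' one_pos, one_pow]
  have h0 := Real.sqrt_nonneg r
  have h2 : (r : ℂ) = (√r : ℝ) * (√r : ℝ) := by
    rw [← Complex.ofReal_mul, Real.mul_self_sqrt hr]
  obtain ⟨B, -, hB⟩ := exists_norm_symbol_le hθ h0 h1
  obtain ⟨B', hB'⟩ := norm_linear_phaseSymbol_le hθ h0 h1 v
  have h := (hasDerivAt_phase_line hθ h0 h1 q v y).const_mul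
    (diag fun i => Complex.I * (θ i v : ℝ) * ((√r : ℝ) : ℂ) ^ deg i)
  refine HasDerivAt.congr_deriv (h.congr_of_eventuallyEq (Filter.Eventually.of_forall fun z => ?_))
    ?_
  · simp only [phase]
    rw [ContinuousLinearMap.mul_def, diag_comp (hB v) (norm_phaseSymbol_le h0 h1.le _)]
    congr 1
    funext i
    rw [phaseSymbol, phaseSymbol, h2, mul_pow]
    ring
  · rw [ContinuousLinearMap.mul_def, diag_comp (hB v) (hB' (q + y • v))]
    congr 1
    funext i
    rw [phaseSymbol, phaseSymbol, h2, mul_pow]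
    linear_combination (θ i v : ℂ) ^ 2 * ((√r : ℝ) : ℂ) ^ deg i * ((√r : ℝ) : ℂ) ^ deg i *
      Complex.exp (Complex.I * (θ i (q + y • v) : ℝ)) * Complex.I_sq

end Flow

/-! ### Graded frequencies, plane waves, and functions on the torus. -/

section Field
variable {d K : ℕ}

variable (d K) in
/-- The pairs of a degree `n` and a frequency `k` whose components are at most `K n`. -/
def gradedFreq : AddSubmonoid (ℕ × (Fin d → ℤ)) where
  carrier := {p | ∀ j, |p.2 j| ≤ K * p.1}
  add_mem' {p q} hp hq j := by
    have h1 := hp j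
    have h2 := hq j
    have h3 := abs_add_le (p.2 j) (q.2 j)
    simp only [Prod.snd_add, Prod.fst_add, Pi.add_apply]
    push_cast
    linarith
  zero_mem' j := by simp

variable (d K) in
/-- The index set of the graded Wiener algebra. -/
abbrev Idx : Type := ↥(gradedFreq d K)

/-- The degree of an index. -/
def Idx.deg (i : Idx d K) : ℕ := i.1.1

/-- The frequency of an index. -/
def Idx.freq (i : Idx d K) : Fin d → ℤ := i.1.2

/-- The index with the opposite frequency. -/
def Idx.conj (i : Idx d K) : Idx d K := ⟨(i.1.1, -i.1.2), fun j => by simpa using i.2 j⟩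

theorem Idx.deg_add (i j : Idx d K) : (i + j).deg = i.deg + j.deg := rfl
theorem Idx.freq_add (i j : Idx d K) : (i + j).freq = i.freq + j.freq := rfl
theorem Idx.deg_conj (i : Idx d K) : i.conj.deg = i.deg := rfl
theorem Idx.freq_conj (i : Idx d K) : i.conj.freq = -i.freq := rfl

theorem Idx.abs_freq_le (i : Idx d K) (j : Fin d) : |(i.freq j : ℝ)| ≤ K * i.deg := by
  exact_mod_cast i.2 j

/-- The phase `N k · x - ½ N² |k|² t` of a plane wave of the free equation, as a function of
`(t, x)`. -/
def planePhase (N : ℕ) (i : Idx d K) : ℝ × (Fin d → ℝ) →L[ℝ] ℝ :=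
  (-((N : ℝ) ^ 2 / 2 * ∑ j, (i.freq j : ℝ) ^ 2)) • ContinuousLinearMap.fst ℝ ℝ (Fin d → ℝ)
    + ∑ j, (N * (i.freq j : ℝ)) •
      (ContinuousLinearMap.proj j).comp (ContinuousLinearMap.snd ℝ ℝ (Fin d → ℝ))

theorem planePhase_apply (N : ℕ) (i : Idx d K) (t : ℝ) (x : Fin d → ℝ) :
    planePhase N i (t, x) = -((N : ℝ) ^ 2 / 2 * ∑ j, (i.freq j : ℝ) ^ 2) * t
      + ∑ j, N * (i.freq j : ℝ) * x j := by
  simp [planePhase]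

/-- The constraint `|k j| ≤ K * deg` bounds frequencies by the degree, so the dispersion relation
grows at most quadratically in it. This is the growth condition of the phase calculus. -/
theorem norm_planePhase_le (N : ℕ) (i : Idx d K) :
    ‖planePhase N i‖ ≤ ((N : ℝ) ^ 2 * d * K ^ 2 + N * d * K) * ((i.deg : ℝ) + 1) ^ 2 := by
  refine ContinuousLinearMap.opNorm_le_bound _ (by positivity) fun q => ?_
  obtain ⟨t, x⟩ := q
  have ht : |t| ≤ ‖(t, x)‖ := norm_fst_le (t, x)
  have hx : ∀ j, |x j| ≤ ‖(t, x)‖ := fun j => (norm_le_pi_norm x j).trans (norm_snd_le (t, x))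
  set M := ‖(t, x)‖
  have hM : 0 ≤ M := (abs_nonneg t).trans ht
  have h1 : ∑ j, (i.freq j : ℝ) ^ 2 ≤ d * (K * i.deg) ^ 2 := by
    refine (Finset.sum_le_card_nsmul _ _ ((K * i.deg : ℝ) ^ 2) fun j _ => ?_).trans (by simp)
    rw [← sq_abs]
    exact pow_le_pow_left₀ (abs_nonneg _) (i.abs_freq_le j) 2
  have h2 : |∑ j, N * (i.freq j : ℝ) * x j| ≤ d * (N * (K * i.deg) * M) := by
    refine (Finset.abs_sum_le_sum_abs _ _).trans
      ((Finset.sum_le_card_nsmul _ _ (N * (K * i.deg : ℝ) * M) fun j _ => ?_).trans (by simp))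
    rw [abs_mul, abs_mul, Nat.abs_cast]
    gcongr
    · exact i.abs_freq_le j
    · exact hx j
  have h0 : 0 ≤ ∑ j, (i.freq j : ℝ) ^ 2 := Finset.sum_nonneg fun j _ => sq_nonneg _
  have h3 : |-((N : ℝ) ^ 2 / 2 * ∑ j, (i.freq j : ℝ) ^ 2) * t|
      ≤ (N : ℝ) ^ 2 / 2 * (d * (K * i.deg) ^ 2) * M := by
    rw [abs_mul, abs_neg, abs_of_nonneg (by positivity)]
    gcongr
  have hn : (0 : ℝ) ≤ i.deg := Nat.cast_nonneg _
  have h4 : (i.deg : ℝ) ^ 2 / 2 ≤ ((i.deg : ℝ) + 1) ^ 2 := by nlinarith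
  have h5 : (i.deg : ℝ) ≤ ((i.deg : ℝ) + 1) ^ 2 := by nlinarith
  rw [planePhase_apply, Real.norm_eq_abs]
  calc _ ≤ (N : ℝ) ^ 2 / 2 * (d * (K * i.deg) ^ 2) * M + d * (N * (K * i.deg) * M) :=
        (abs_add_le _ _).trans (add_le_add h3 h2)
    _ = (N : ℝ) ^ 2 * d * K ^ 2 * ((i.deg : ℝ) ^ 2 / 2) * M + N * d * K * (i.deg : ℝ) * M := by ring
    _ ≤ (N : ℝ) ^ 2 * d * K ^ 2 * ((i.deg : ℝ) + 1) ^ 2 * M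
        + N * d * K * ((i.deg : ℝ) + 1) ^ 2 * M := by gcongr
    _ = _ := by ring

/-- The phase operators of the free equation. -/
abbrev freePhase (N : ℕ) (r : ℝ) (q : ℝ × (Fin d → ℝ)) : L1 (Idx d K) →L[ℂ] L1 (Idx d K) :=
  phase Idx.deg (planePhase N) r q

/-- The character `e^{i N k · x}` as a function of the index. -/
def waveSymbol (N : ℕ) (x : Fin d → ℝ) (i : Idx d K) : ℂ :=
  Complex.exp (Complex.I * (∑ j, N * (i.freq j : ℝ) * x j : ℝ))

theorem norm_waveSymbol (N : ℕ) (x : Fin d → ℝ) (i : Idx d K) : ‖waveSymbol N x i‖ = 1 := by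
  rw [waveSymbol, mul_comm, Complex.norm_exp_ofReal_mul_I]

theorem waveSymbol_add (N : ℕ) (x : Fin d → ℝ) (i j : Idx d K) :
    waveSymbol N x (i + j) = waveSymbol N x i * waveSymbol N x j := by
  simp only [waveSymbol, ← Complex.exp_add, Idx.freq_add, Pi.add_apply, Int.cast_add, add_mul,
    mul_add, Finset.sum_add_distrib, Complex.ofReal_add]

theorem waveSymbol_conj (N : ℕ) (x : Fin d → ℝ) (i : Idx d K) :
    waveSymbol N x i.conj = (starRingEnd ℂ) (waveSymbol N x i) := by
  simp only [waveSymbol, ← Complex.exp_conj, map_mul, Complex.conj_I, Complex.conj_ofReal,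
    Idx.freq_conj, Pi.neg_apply, Int.cast_neg, mul_neg, neg_mul, Finset.sum_neg_distrib,
    Complex.ofReal_neg]

/-- The value at `x` of the function with the given coefficients. -/
def evalAt (N : ℕ) (x : Fin d → ℝ) : L1 (Idx d K) →L[ℂ] ℂ := l1Lift (waveSymbol N x)

theorem evalAt_conv (N : ℕ) (x : Fin d → ℝ) (a b : L1 (Idx d K)) :
    evalAt N x (conv a b) = evalAt N x a * evalAt N x b :=
  l1Lift_conv (fun i => (norm_waveSymbol N x i).le) (waveSymbol_add N x) a b

theorem evalAt_conj (N : ℕ) (x : Fin d → ℝ) (a : L1 (Idx d K)) :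
    evalAt N x (conjMap Idx.conj a) = (starRingEnd ℂ) (evalAt N x a) :=
  l1Lift_conjMap (fun i => (norm_waveSymbol N x i).le) (waveSymbol_conj N x) a

theorem evalAt_unitVec (N : ℕ) (x : Fin d → ℝ) (i : Idx d K) :
    evalAt N x (unitVec i) = waveSymbol N x i :=
  l1Lift_unitVec (fun i => (norm_waveSymbol N x i).le) i

/-- Translation in space is itself a phase operator. Hence `t` and `x` derivatives can be treated
together, with evaluation at `0` as a fixed functional. -/
theorem evalAt_eq (N : ℕ) (x : Fin d → ℝ) (a : L1 (Idx d K)) :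
    evalAt N x a = evalAt N 0 (freePhase N 1 (0, x) a) := by
  have h : evalAt N x = (evalAt N 0).comp (freePhase (K := K) N 1 (0, x)) := by
    refine L1.clm_ext fun i => ?_
    rw [ContinuousLinearMap.comp_apply, phase_unitVec zero_le_one le_rfl, map_smul, evalAt_unitVec,
      evalAt_unitVec]
    simp [waveSymbol, phaseSymbol, planePhase_apply]
  rw [h]
  rfl

theorem evalAt_add_single (N : ℕ) (x : Fin d → ℝ) (l : Fin d) :
    evalAt (K := K) N (x + Pi.single l (2 * Real.pi)) = evalAt N x := by
  refine L1.clm_ext fun i => ?_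
  rw [evalAt_unitVec, evalAt_unitVec, waveSymbol, waveSymbol]
  have h : (∑ j, N * (i.freq j : ℝ) * (x + Pi.single l (2 * Real.pi) : Fin d → ℝ) j)
      = (∑ j, N * (i.freq j : ℝ) * x j) + N * (i.freq l : ℝ) * (2 * Real.pi) := by
    simp [mul_add, Finset.sum_add_distrib, Pi.single_apply]
  rw [h]
  refine Complex.exp_eq_exp_iff_exists_int.2 ⟨N * i.freq l, ?_⟩
  push_cast
  ring

theorem contDiff_freePhase (N : ℕ) {r : ℝ} (hr : 0 ≤ r) (hr1 : r < 1) :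
    ContDiff ℝ ∞ (freePhase (d := d) (K := K) N r) :=
  contDiff_phase (norm_planePhase_le N) hr hr1

/-- The smooth function on the torus with the coefficients `2 ^ (-deg i) bᵢ`. -/
def synth (N : ℕ) (b : L1 (Idx d K)) : SmoothTorus d :=
  ⟨fun x => evalAt N x (degScale Idx.deg (1 / 2) b), by
    refine ⟨?_, fun x l => by beta_reduce; rw [evalAt_add_single]⟩
    have h : (fun x => evalAt N x (degScale Idx.deg (1 / 2) b))
        = fun x => evalAt N 0 (freePhase N (1 / 2) (0, x) b) := by
      funext x
      rw [evalAt_eq, phase_comp_degScale zero_le_one le_rfl (by norm_num) (by norm_num), one_mul]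
    rw [h]
    refine ((evalAt N 0).restrictScalars ℝ).contDiff.comp
      (isBoundedBilinearMap_clmApply.contDiff.comp (ContDiff.prodMk
        (f := fun x => freePhase N (1 / 2) (0, x)) ?_ contDiff_const))
    exact (contDiff_freePhase N (by norm_num) (by norm_num)).comp (by fun_prop)⟩

theorem synth_apply (N : ℕ) (b : L1 (Idx d K)) (x : Fin d → ℝ) :
    synth N b x = evalAt N x (degScale Idx.deg (1 / 2) b) := rfl

/-- The field with the coefficients `a t` in the interaction picture, up to the factors
`4 ^ (-deg i)`. -/
def field (N : ℕ) (a : ℝ → L1 (Idx d K)) (t : ℝ) : SmoothTorus d :=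
  synth N (freePhase N (1 / 2) (t, 0) (a t))

/-- The total weight `1/4` appears as two halves: one makes the phase smooth in `(t, x)`, the other
makes the coefficients smooth in `t`. -/
theorem field_apply (N : ℕ) (a : ℝ → L1 (Idx d K)) (t : ℝ) (x : Fin d → ℝ) :
    field N a t x = evalAt N 0 (freePhase N (1 / 2) (t, x) (degScale Idx.deg (1 / 2) (a t))) := by
  rw [field, synth_apply, evalAt_eq, phase_comp_degScale zero_le_one le_rfl (by norm_num)
    (by norm_num), phase_phase (by norm_num) (by norm_num) (by norm_num) (by norm_num),
    phase_comp_degScale (by norm_num) (by norm_num)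
    (by norm_num) (by norm_num)]
  simp

end Field

/-! ### Graded coefficients give smooth solutions of the equation. -/

section Solution
variable {d K : ℕ}

theorem contDiffOn_field (N : ℕ) {a : ℝ → L1 (Idx d K)} {J : Set ℝ}
    (ha : ContDiffOn ℝ ∞ (fun t => degScale Idx.deg (1 / 2) (a t)) J) :
    ContDiffOn ℝ ∞ (fun q : ℝ × (Fin d → ℝ) => field N a q.1 q.2) (J ×ˢ Set.univ) := by
  have h : ContDiffOn ℝ ∞ (fun q : ℝ × (Fin d → ℝ) =>
      evalAt N 0 (freePhase N (1 / 2) q (degScale Idx.deg (1 / 2) (a q.1)))) (J ×ˢ Set.univ) := by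
    refine ((evalAt N 0).restrictScalars ℝ).contDiff.comp_contDiffOn
      (isBoundedBilinearMap_clmApply.contDiff.comp_contDiffOn (ContDiffOn.prodMk
        (contDiff_freePhase N (by norm_num) (by norm_num)).contDiffOn ?_))
    exact ha.comp contDiff_fst.contDiffOn fun q hq => hq.1
  exact h.congr fun q _ => field_apply N a q.1 q.2

theorem hasDerivAt_field (N : ℕ) {a : ℝ → L1 (Idx d K)} {t : ℝ} {a' : L1 (Idx d K)}
    (ha : HasDerivAt a a' t) (x : Fin d → ℝ) :
    HasDerivAt (fun τ => field N a τ x)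
      (evalAt N 0 (freePhase N (1 / 2) (t, x) (degScale Idx.deg (1 / 2) a'))
        + evalAt N 0 ((diag fun i => Complex.I * (planePhase N i (1, 0) : ℝ) *
          phaseSymbol Idx.deg (planePhase N) (1 / 2) (t, x) i) (degScale Idx.deg (1 / 2) (a t))))
      t := by
  have h1 := hasDerivAt_phase_line (norm_planePhase_le (d := d) (K := K) N) (r := 1 / 2)
    (by norm_num) (by norm_num) (0, x) (1, 0) t
  have hq : ∀ τ : ℝ, ((0, x) : ℝ × (Fin d → ℝ)) + τ • (1, 0) = (τ, x) := fun τ => by simp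
  simp only [hq] at h1
  have h2 : HasDerivAt (fun τ => degScale Idx.deg (1 / 2) (a τ)) (degScale Idx.deg (1 / 2) a') t :=
    ((degScale Idx.deg (1 / 2)).restrictScalars ℝ).hasFDerivAt.comp_hasDerivAt t ha
  have h3 := (isBoundedBilinearMap_clmApply.hasFDerivAt _).comp_hasDerivAt t (h1.prodMk h2)
  have h4 := ((evalAt N 0).restrictScalars ℝ).hasFDerivAt.comp_hasDerivAt t h3
  refine HasDerivAt.congr_deriv (h4.congr_of_eventuallyEq
    (Filter.Eventually.of_forall fun τ => field_apply N a τ x)) ?_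
  rw [← map_add]
  rfl

theorem iteratedDeriv_field (N : ℕ) (a : ℝ → L1 (Idx d K)) (t : ℝ) (x : Fin d → ℝ) (l : Fin d) :
    iteratedDeriv 2 (fun y : ℝ => field N a t (Function.update x l y)) (x l)
      = evalAt N 0 ((diag fun i => -(planePhase N i (0, Pi.single l 1) : ℂ) ^ 2 *
          phaseSymbol Idx.deg (planePhase N) (1 / 2) (t, x) i) (degScale Idx.deg (1 / 2) (a t))) := by
  set b := degScale Idx.deg (1 / 2) (a t) with hb
  set v : ℝ × (Fin d → ℝ) := (0, Pi.single l 1) with hv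
  -- Setting the `l`-th coordinate to `0` makes the coordinate slice the line `q + y • v`, to which
  -- the phase derivatives apply.
  set q : ℝ × (Fin d → ℝ) := (t, Function.update x l 0) with hq
  have hqv : ∀ y : ℝ, (t, Function.update x l y) = q + y • v := by
    intro y
    rw [hq, hv]
    refine Prod.ext (by simp) ?_
    funext j
    by_cases hj : j = l
    · subst hj
      simp
    · simp [hj]
  have happly : ∀ {T : ℝ → L1 (Idx d K) →L[ℂ] L1 (Idx d K)} {T'} {y : ℝ}, HasDerivAt T T' y →
      HasDerivAt (fun y => evalAt N 0 (T y b)) (evalAt N 0 (T' b)) y := by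
    intro T T' y hT
    have h := (isBoundedBilinearMap_clmApply.hasFDerivAt _).comp_hasDerivAt y
      (hT.prodMk (hasDerivAt_const y b))
    refine (((evalAt N 0).restrictScalars ℝ).hasFDerivAt.comp_hasDerivAt y h).congr_deriv ?_
    change evalAt N 0 (T y 0 + T' b) = _
    rw [map_zero, zero_add]
  have hf : (fun y : ℝ => field N a t (Function.update x l y))
      = fun y => evalAt N 0 (freePhase N (1 / 2) (q + y • v) b) := by
    funext y
    rw [field_apply, hqv]
  have hx : q + x l • v = (t, x) := by
    rw [← hqv, Function.update_eq_self]
  have h1 := fun y => happly (hasDerivAt_phase_line (norm_planePhase_le (d := d) (K := K) N)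
    (r := 1 / 2) (by norm_num) (by norm_num) q v y)
  have h2 := fun y => happly (hasDerivAt_phase_line_snd (norm_planePhase_le (d := d) (K := K) N)
    (r := 1 / 2) (by norm_num) (by norm_num) q v y)
  rw [hf, iteratedDeriv_succ, iteratedDeriv_one, funext fun y => (h1 y).deriv, (h2 (x l)).deriv, hx]

/-- This is the dispersion relation: `i ∂ₜ` gives `N² |k|² / 2` on each plane wave, and `½ Δ` gives
its negative. -/
theorem linear_part_cancel (N : ℕ) (q : ℝ × (Fin d → ℝ)) (b : L1 (Idx d K)) :
    Complex.I * evalAt N 0 ((diag fun i => Complex.I * (planePhase N i (1, 0) : ℝ) *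
        phaseSymbol Idx.deg (planePhase N) (1 / 2) q i) b)
      + 1 / 2 * ∑ l, evalAt N 0 ((diag fun i => -(planePhase N i (0, Pi.single l 1) : ℂ) ^ 2 *
        phaseSymbol Idx.deg (planePhase N) (1 / 2) q i) b) = 0 := by
  have hθ := norm_planePhase_le (d := d) (K := K) N
  obtain ⟨B, hB⟩ := norm_linear_phaseSymbol_le hθ (r := 1 / 2) (by norm_num) (by norm_num) (1, 0)
  have hB' := fun l : Fin d => norm_quadratic_phaseSymbol_le hθ (r := 1 / 2) (by norm_num)
    (by norm_num) (0, Pi.single l 1)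
  choose D hD using hB'
  have h : (Complex.I • diag fun i : Idx d K => Complex.I * (planePhase N i (1, 0) : ℝ) *
        phaseSymbol Idx.deg (planePhase N) (1 / 2) q i)
      + (1 / 2 : ℂ) • ∑ l, (diag fun i : Idx d K => -(planePhase N i (0, Pi.single l 1) : ℂ) ^ 2 *
        phaseSymbol Idx.deg (planePhase N) (1 / 2) q i) = 0 := by
    refine L1.clm_ext fun i => ?_
    simp only [add_apply, smul_apply, sum_apply, zero_apply]
    rw [diag_unitVec (hB q), Finset.sum_congr rfl fun l _ => diag_unitVec (hD l q) i,
      ← Finset.sum_smul, smul_smul, smul_smul, ← add_smul, ← Finset.sum_mul]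
    have h1 : ∀ l, planePhase N i (0, Pi.single l 1) = N * (i.freq l : ℝ) := fun l => by
      simp [planePhase_apply, Pi.single_apply]
    have h2 : planePhase N i (1, 0) = -((N : ℝ) ^ 2 / 2 * ∑ j, (i.freq j : ℝ) ^ 2) := by
      simp [planePhase_apply]
    rw [h2]
    simp only [h1]
    convert zero_smul ℂ _ using 2
    push_cast
    simp only [mul_pow, Finset.sum_neg_distrib, ← Finset.mul_sum]
    linear_combination (-(N : ℂ) ^ 2 / 2 * (∑ j, (i.freq j : ℂ) ^ 2)
      * phaseSymbol Idx.deg (planePhase N) (1 / 2) q i) * Complex.I_sq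
  have h' := congrArg (fun T => evalAt N 0 (T b)) h
  simp only [add_apply, smul_apply, sum_apply, zero_apply, map_add, map_smul, map_sum, map_zero,
    smul_eq_mul] at h'
  exact h'

/-- The free part cancels, and the derivative of `a` leaves `F` at weight `1`, damped from outside
by `1/4`. Since `F` commutes with degree weights, the damping moves inside and gives the
nonlinearity of the damped field. -/
theorem isSmoothSolution_field {N σ : ℕ} {C : ℝ} {F : L1 (Idx d K) → L1 (Idx d K)}
    (hF : IsAdmissible Idx.deg σ C F) {Φ : SmoothTorus d → (Fin d → ℝ) → ℂ}
    (hΦ : ∀ b x, Φ (synth N b) x = evalAt N x (F (degScale Idx.deg (1 / 2) b)))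
    {τ : ℝ} (hτ : 0 < τ) {a : ℝ → L1 (Idx d K)}
    (ha : ∀ t ∈ Set.Ioo (-τ) τ, HasDerivAt a
      (interaction Idx.deg (planePhase N) (1, 0) F t (a t)) t) :
    IsSmoothSolution Φ (Set.Ioo (-τ) τ) (field N a) where
  isOpen := isOpen_Ioo
  ordConnected := Set.ordConnected_Ioo
  zero_mem := ⟨by linarith, hτ⟩
  contDiffOn := contDiffOn_field N (contDiffOn_degScale hF (norm_planePhase_le N) isOpen_Ioo ha
    (by norm_num) (by norm_num))
  equation t ht x := by
    rw [(hasDerivAt_field N (ha t ht) x).deriv, torusLaplacian,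
      Finset.sum_congr rfl fun l _ => iteratedDeriv_field N a t x l, mul_add, add_assoc,
      linear_part_cancel, add_zero, field, hΦ]
    have hte : t • ((1, 0) : ℝ × (Fin d → ℝ)) = (t, 0) := by simp
    have hte' : -t • ((1, 0) : ℝ × (Fin d → ℝ)) = (-t, 0) := by simp
    rw [degScale_phase (by norm_num) (by norm_num) (by norm_num) (by norm_num),
      phase_comp_degScale (by norm_num) (by norm_num) (by norm_num) (by norm_num),
      interaction, map_smul, map_smul, phase_phase (by norm_num) (by norm_num) zero_le_one le_rfl,
      hte, hte', evalAt_eq N x]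
    have h1 : freePhase (K := K) N (1 / 2 * (1 / 2)) (t, 0) (a t)
        = degScale Idx.deg (1 / 2 * (1 / 2)) (freePhase N 1 (t, 0) (a t)) := by
      rw [degScale_phase (by norm_num) (by norm_num) zero_le_one le_rfl, mul_one]
    rw [h1, hF.map_degScale _ (by norm_num) (by norm_num),
      phase_comp_degScale zero_le_one le_rfl (by norm_num) (by norm_num), smul_eq_mul, ← mul_assoc]
    simp

end Solution

/-! ### Fourier coefficients, the zero mode, and the concrete nonlinearities. -/

section Coefficients
variable {d K : ℕ}

theorem integral_Icc_exp (k : ℤ) :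
    ∫ y in Set.Icc 0 (2 * Real.pi), Complex.exp (Complex.I * ((k : ℝ) * y : ℝ))
      = if k = 0 then ((2 * Real.pi : ℝ) : ℂ) else 0 := by
  rw [MeasureTheory.integral_Icc_eq_integral_Ioc, ← intervalIntegral.integral_of_le
    (by positivity)]
  split_ifs with hk
  · simp [hk]
  · have h1 : Complex.I * (k : ℂ) ≠ 0 := mul_ne_zero Complex.I_ne_zero (by exact_mod_cast hk)
    have h2 : (fun y : ℝ => Complex.exp (Complex.I * ((k : ℝ) * y : ℝ)))
        = fun y : ℝ => Complex.exp (Complex.I * (k : ℂ) * y) := by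
      funext y
      push_cast
      rw [mul_assoc]
    rw [h2, integral_exp_mul_complex h1]
    have h3 : Complex.exp (Complex.I * (k : ℂ) * (2 * Real.pi : ℝ)) = 1 := by
      rw [Complex.exp_eq_one_iff]
      refine ⟨k, ?_⟩
      push_cast
      ring
    rw [h3]
    simp

theorem integral_cell_exp (k : Fin d → ℤ) :
    ∫ x in cell d, Complex.exp (Complex.I * (∑ j, (k j : ℝ) * x j : ℝ))
      = if k = 0 then ((2 * Real.pi : ℝ) : ℂ) ^ d else 0 := by
  have h1 : cell d = Set.univ.pi fun _ => Set.Icc 0 (2 * Real.pi) := by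
    rw [Set.pi_univ_Icc]
    rfl
  have h2 : (fun x : Fin d → ℝ => Complex.exp (Complex.I * (∑ j, (k j : ℝ) * x j : ℝ)))
      = fun x => ∏ j, Complex.exp (Complex.I * ((k j : ℝ) * x j : ℝ)) := by
    funext x
    rw [← Complex.exp_sum, Complex.ofReal_sum, Finset.mul_sum]
  rw [h1, h2, MeasureTheory.volume_pi, MeasureTheory.Measure.restrict_pi_pi,
    MeasureTheory.integral_fintype_prod_eq_prod
      (fun j (y : ℝ) => Complex.exp (Complex.I * ((k j : ℝ) * y : ℝ)))]
  simp only [integral_Icc_exp]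
  split_ifs with hk
  · simp [hk]
  · obtain ⟨j, hj⟩ := Function.ne_iff.1 hk
    exact Finset.prod_eq_zero (Finset.mem_univ j) (if_neg hj)

/-- The indicator of the zero frequency. -/
def zeroInd (i : Idx d K) : ℂ := if i.freq = 0 then 1 else 0

theorem norm_zeroInd_le (i : Idx d K) : ‖zeroInd i‖ ≤ 1 := by
  rw [zeroInd]
  split_ifs <;> simp

/-- The mean of the function with the given coefficients. -/
def zeroMode : L1 (Idx d K) →L[ℂ] ℂ := l1Lift zeroInd

theorem zeroMode_unitVec (i : Idx d K) : zeroMode (unitVec i) = zeroInd i :=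
  l1Lift_unitVec norm_zeroInd_le i

theorem integral_waveSymbol {N : ℕ} (hN : N ≠ 0) (i : Idx d K) :
    ∫ x in cell d, waveSymbol N x i = ((2 * Real.pi : ℝ) : ℂ) ^ d * zeroInd i := by
  have h := integral_cell_exp fun j => (N : ℤ) * i.freq j
  have h1 : ((fun j => (N : ℤ) * i.freq j) = 0) ↔ i.freq = 0 := by
    simp [funext_iff, hN]
  simp only [h1, Int.cast_mul, Int.cast_natCast] at h
  simp only [waveSymbol, zeroInd, h]
  split_ifs <;> simp

theorem integral_evalAt {N : ℕ} (hN : N ≠ 0) (w : L1 (Idx d K)) :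
    ∫ x in cell d, evalAt N x w = ((2 * Real.pi : ℝ) : ℂ) ^ d * zeroMode w := by
  have hcont : ∀ i : Idx d K, Continuous fun x : Fin d → ℝ => waveSymbol N x i := fun i => by
    unfold waveSymbol
    fun_prop
  have h1 : ∀ x, evalAt N x w = ∑' i, w i • waveSymbol N x i := fun x =>
    l1Lift_apply (fun i => (norm_waveSymbol N x i).le) w
  have h2 := MeasureTheory.integral_tsum_of_summable_integral_norm
    (μ := MeasureTheory.volume.restrict (cell d)) (F := fun i x => w i • waveSymbol N x i)
    (fun i => ((integrableOn_cell (hcont i)).smul (w i))) (by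
      simp only [norm_smul, norm_waveSymbol, mul_one]
      simp only [MeasureTheory.integral_const, smul_eq_mul]
      exact w.summable_norm.mul_left _)
  simp only [h1]
  rw [← h2, zeroMode, l1Lift_apply norm_zeroInd_le, ← tsum_mul_left]
  refine tsum_congr fun i => ?_
  rw [MeasureTheory.integral_smul, integral_waveSymbol hN, smul_eq_mul, smul_eq_mul]
  ring

theorem two_pi_pow_ne_zero : (((2 * Real.pi : ℝ) : ℂ) ^ d) ≠ 0 :=
  pow_ne_zero _ (by exact_mod_cast (by positivity : (2 * Real.pi : ℝ) ≠ 0))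

theorem distFourierCoeff_toDistribution (f : SmoothTorus d) (k : Fin d → ℤ) :
    distFourierCoeff (toDistribution f) k
      = (((2 * Real.pi : ℝ) : ℂ) ^ d)⁻¹ *
        ∫ x in cell d, f x * Complex.exp (Complex.I * (∑ j, ((-k) j : ℝ) * x j : ℝ)) := by
  simp [distFourierCoeff, toDistribution, character]

theorem distFourierCoeff_synth_zero {N : ℕ} (hN : N ≠ 0) (b : L1 (Idx d K)) :
    distFourierCoeff (toDistribution (synth N b)) 0 = zeroMode (degScale Idx.deg (1 / 2) b) := by
  rw [distFourierCoeff_toDistribution]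
  have h : ∀ x : Fin d → ℝ, synth N b x
      * Complex.exp (Complex.I * (∑ j, ((-(0 : Fin d → ℤ)) j : ℝ) * x j : ℝ))
      = evalAt N x (degScale Idx.deg (1 / 2) b) := fun x => by
    simp [synth_apply]
  simp only [h]
  rw [integral_evalAt hN, ← mul_assoc, inv_mul_cancel₀ two_pi_pow_ne_zero, one_mul]

/-- At `x = 0` the phase vanishes on frequency zero: the free flow preserves the mean. The zero mode
can thus be read off in the interaction picture. -/
theorem zeroMode_degScale_phase (N : ℕ) {r : ℝ} (hr : 0 ≤ r) (hr1 : r ≤ 1) (t : ℝ)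
    (a : L1 (Idx d K)) :
    zeroMode (freePhase N r (t, 0) a) = zeroMode (degScale Idx.deg r a) := by
  have h : (zeroMode (d := d) (K := K)).comp (freePhase N r (t, 0))
      = zeroMode.comp (degScale Idx.deg r) := by
    refine L1.clm_ext fun i => ?_
    rw [ContinuousLinearMap.comp_apply, ContinuousLinearMap.comp_apply, phase_unitVec hr hr1,
      degScale, diag_unitVec (norm_pow_deg_le _ hr hr1), map_smul, map_smul, zeroMode_unitVec,
      zeroInd]
    split_ifs with h0
    · simp [phaseSymbol, planePhase_apply, h0]
    · simp
  exact DFunLike.congr_fun h a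

theorem distFourierCoeff_field_zero {N : ℕ} (hN : N ≠ 0) (a : ℝ → L1 (Idx d K)) (t : ℝ) :
    distFourierCoeff (toDistribution (field N a t)) 0
      = zeroMode (degScale Idx.deg (1 / 4) (a t)) := by
  rw [field, distFourierCoeff_synth_zero hN, degScale_phase (by norm_num) (by norm_num)
    (by norm_num) (by norm_num), zeroMode_degScale_phase N (by norm_num) (by norm_num)]
  norm_num

theorem evalAt_oddPower (N : ℕ) (x : Fin d → ℝ) (n : ℕ) (u : L1 (Idx d K)) :
    evalAt N x (oddPower Idx.conj n u) = ((‖evalAt N x u‖ ^ (2 * n) : ℝ) : ℂ) * evalAt N x u := by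
  induction n with
  | zero => simp [oddPower]
  | succ n ih =>
    rw [oddPower, evalAt_conv, evalAt_conv, evalAt_conj, ih, ← mul_assoc, Complex.mul_conj,
      Complex.normSq_eq_norm_sq, ← mul_assoc, ← Complex.ofReal_mul, ← pow_add]
    congr 3
    ring

theorem nlsTerm_synth (N σ : ℕ) (μ : ℝ) (b : L1 (Idx d K)) (x : Fin d → ℝ) :
    nlsTerm μ σ (synth N b) x
      = evalAt N x ((μ : ℂ) • oddPower Idx.conj σ (degScale Idx.deg (1 / 2) b)) := by
  rw [map_smul, evalAt_oddPower, nlsTerm, synth_apply, smul_eq_mul, mul_assoc]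

theorem evalAt_diag_zeroInd (N : ℕ) (x : Fin d → ℝ) (w : L1 (Idx d K)) :
    evalAt N x (diag zeroInd w) = zeroMode w := by
  have h : (evalAt N x).comp (diag zeroInd) = (zeroMode : L1 (Idx d K) →L[ℂ] ℂ) := by
    refine L1.clm_ext fun i => ?_
    rw [ContinuousLinearMap.comp_apply, diag_unitVec norm_zeroInd_le, map_smul, zeroMode_unitVec,
      evalAt_unitVec, zeroInd]
    split_ifs with h0
    · simp [waveSymbol, h0]
    · simp
  exact DFunLike.congr_fun h w

/-- The renormalized cubic nonlinearity on the Fourier side. -/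
def renormalizedPower (u : L1 (Idx d K)) : L1 (Idx d K) :=
  oddPower Idx.conj 1 u + (-2 : ℂ) • massTerm Idx.conj zeroInd u

theorem renormalizedTerm_synth {N : ℕ} (hN : N ≠ 0) (μ : ℝ) (b : L1 (Idx d K)) (x : Fin d → ℝ) :
    renormalizedTerm μ (synth N b) x
      = evalAt N x ((μ : ℂ) • renormalizedPower (degScale Idx.deg (1 / 2) b)) := by
  set w := degScale Idx.deg (1 / 2) b with hw
  -- The mass is the zero mode of `|ψ|²`; its factor `(2π)^d` cancels the one in the
  -- renormalization.
  have h1 : ((∫ y in cell d, ‖synth N b y‖ ^ 2 : ℝ) : ℂ)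
      = ((2 * Real.pi : ℝ) : ℂ) ^ d * zeroMode (conv w (conjMap Idx.conj w)) := by
    rw [← integral_evalAt hN]
    refine Eq.trans (integral_complex_ofReal).symm ?_
    congr 1
    funext y
    rw [evalAt_conv, evalAt_conj, Complex.mul_conj, Complex.normSq_eq_norm_sq]
    rfl
  rw [renormalizedTerm, Complex.ofReal_mul, h1, renormalizedPower, map_smul, map_add, map_smul,
    evalAt_oddPower, massTerm, evalAt_conv, evalAt_diag_zeroInd, synth_apply, ← hw]
  have h2 : ((2 * Real.pi : ℝ) : ℂ) ^ d ≠ 0 := two_pi_pow_ne_zero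
  push_cast at h2 ⊢
  simp only [smul_eq_mul]
  field_simp
  ring

theorem renormalizedPower_isAdmissible :
    IsAdmissible Idx.deg 1 9 (renormalizedPower (d := d) (K := K)) := by
  have h := (oddPower_isAdmissible (ι := Idx d K) Idx.deg_add Idx.deg_conj 1).add
    ((massTerm_isAdmissible Idx.deg_add Idx.deg_conj norm_zeroInd_le).smul (-2 : ℂ))
  have h9 : (9 : ℝ) = 2 * ((1 : ℕ) : ℝ) + 1 + ‖(-2 : ℂ)‖ * 3 := by norm_num
  rw [h9]
  exact h

end Coefficients

/-! ### Multilinear expansion of the nonlinearity on finite sums of modes. -/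

section Tuples
variable {d K : ℕ} {J : Type}

/-- The index set of the expansion of `|u|^{2n} u` when `u` is a sum over `J`. -/
def Tup (J : Type) : ℕ → Type
  | 0 => J
  | n + 1 => J × J × Tup J n

instance instFintypeTup (J : Type) [Fintype J] : ∀ n, Fintype (Tup J n)
  | 0 => inferInstanceAs (Fintype J)
  | n + 1 =>
    letI := instFintypeTup J n
    inferInstanceAs (Fintype (J × J × Tup J n))

/-- The alternating sum `w j₁ - w j₂ + w j₃ - ⋯` over a tuple. -/
def Tup.alt {G : Type*} [AddGroup G] (w : J → G) : ∀ n, Tup J n → G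
  | 0, j => w j
  | n + 1, (j, j', l) => w j + (-w j' + Tup.alt w n l)

/-- The index of the product of unit vectors given by a tuple. -/
def Tup.idx (e : J → Idx d K) : ∀ n, Tup J n → Idx d K
  | 0, j => e j
  | n + 1, (j, j', l) => e j + ((e j').conj + Tup.idx e n l)

theorem Tup.freq_idx (e : J → Idx d K) (n : ℕ) (l : Tup J n) :
    (Tup.idx e n l).freq = Tup.alt (fun j => (e j).freq) n l := by
  induction n with
  | zero => rfl
  | succ n ih =>
    obtain ⟨j, j', l⟩ := l
    rw [Tup.idx, Tup.alt, Idx.freq_add, Idx.freq_add, Idx.freq_conj, ih]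

/-- Conjugation reverses both frequency and phase, so each product of modes carries the alternating
sums of both. -/
theorem oddPower_sum [Fintype J] (e : J → Idx d K) (w : J → ℤ) (B c : ℝ) (n : ℕ) :
    oddPower Idx.conj n
        (∑ j, ((B : ℂ) * Complex.exp (-Complex.I * (c * (w j : ℝ) : ℝ))) • unitVec (e j))
      = ∑ l : Tup J n, ((B : ℂ) ^ (2 * n + 1) *
          Complex.exp (-Complex.I * (c * ((Tup.alt w n l : ℤ) : ℝ) : ℝ))) • unitVec (Tup.idx e n l) := by
  induction n with
  | zero =>
    rw [oddPower, mul_zero, zero_add, pow_one]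
    rfl
  | succ n ih =>
    rw [oddPower, ih]
    have hR : ∀ f : Tup J (n + 1) → L1 (Idx d K),
        ∑ l, f l = ∑ j, ∑ j', ∑ l, f (j, j', l) := fun f => by
      refine (Fintype.sum_prod_type (α₁ := J) (α₂ := J × Tup J n) f).trans ?_
      exact Finset.sum_congr rfl fun j _ => Fintype.sum_prod_type _
    rw [hR]
    simp only [map_sum, conjMap_smul_unitVec, sum_apply, map_smul, smul_apply, conv_unitVec]
    simp only [Finset.smul_sum, smul_smul]
    rw [Finset.sum_comm, Finset.sum_congr rfl fun _ _ => Finset.sum_comm, Finset.sum_comm]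
    refine Finset.sum_congr rfl fun j _ => Finset.sum_congr rfl fun j' _ =>
      Finset.sum_congr rfl fun l _ => ?_
    rw [Tup.idx, Tup.alt]
    congr 1
    have h : (starRingEnd ℂ) (Complex.exp (-Complex.I * (c * (w j' : ℝ) : ℝ)))
        = Complex.exp (Complex.I * (c * (w j' : ℝ) : ℝ)) := by
      rw [← Complex.exp_conj, map_mul, map_neg, Complex.conj_I, neg_neg, Complex.conj_ofReal]
    have h2 : Complex.exp (-Complex.I * (c * ((w j + (-w j' + Tup.alt w n l) : ℤ) : ℝ) : ℝ))
        = Complex.exp (-Complex.I * (c * ((Tup.alt w n l : ℤ) : ℝ) : ℝ))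
          * (Complex.exp (Complex.I * (c * (w j' : ℝ) : ℝ))
            * Complex.exp (-Complex.I * (c * (w j : ℝ) : ℝ))) := by
      rw [← Complex.exp_add, ← Complex.exp_add]
      congr 1
      push_cast
      ring
    rw [map_mul, h, h2, Complex.conj_ofReal]
    ring

end Tuples

/-! ### The data, and the first iterate of the zero mode. -/

section Data
variable {d K : ℕ} {J : Type}

/-- The index of degree one with frequency `k`. -/
def oneIdx (k : Fin d → ℤ) (hk : ∀ l, |k l| ≤ K) : Idx d K :=
  ⟨(1, k), fun l => by simpa using hk l⟩

variable [Fintype J] {k : J → Fin d → ℤ} (hk : ∀ j l, |k j l| ≤ K)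

/-- The coefficients of `A ∑ⱼ e^{i N kⱼ · x}`. -/
def dataVec (A : ℝ) : L1 (Idx d K) := ∑ j, (A : ℂ) • unitVec (oneIdx (k j) (hk j))

theorem norm_dataVec_le {A : ℝ} (hA : 0 ≤ A) : ‖dataVec hk A‖ ≤ Fintype.card J * A := by
  refine (norm_sum_le_of_le _ fun j _ => ?_).trans_eq
    (by rw [Finset.sum_const, Finset.card_univ, nsmul_eq_mul])
  rw [norm_smul, norm_unitVec, mul_one, Complex.norm_real, Real.norm_of_nonneg hA]

theorem degScale_dataVec (A : ℝ) {r : ℝ} (hr : 0 ≤ r) (hr1 : r ≤ 1) :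
    degScale Idx.deg r (dataVec hk A) = dataVec hk (r * A) := by
  rw [dataVec, dataVec, map_sum]
  refine Finset.sum_congr rfl fun j _ => ?_
  rw [map_smul, degScale, diag_unitVec (norm_pow_deg_le _ hr hr1), smul_smul]
  have h : (oneIdx (k j) (hk j)).deg = 1 := rfl
  rw [h, pow_one, Complex.ofReal_mul, mul_comm]

theorem freePhase_dataVec (N : ℕ) (A t : ℝ) :
    freePhase N 1 (t, 0) (dataVec hk A)
      = ∑ j, ((A : ℂ) * Complex.exp (-Complex.I *
          ((N : ℝ) ^ 2 / 2 * t * ((∑ l, k j l ^ 2 : ℤ) : ℝ) : ℝ))) •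
        unitVec (oneIdx (k j) (hk j)) := by
  rw [dataVec, map_sum]
  refine Finset.sum_congr rfl fun j _ => ?_
  rw [map_smul, phase_unitVec zero_le_one le_rfl, smul_smul]
  congr 2
  have h : (oneIdx (k j) (hk j)).freq = k j := rfl
  simp only [phaseSymbol, planePhase_apply, h]
  simp only [Complex.ofReal_one, one_pow, one_mul, Pi.zero_apply, mul_zero, Finset.sum_const_zero,
    add_zero]
  congr 1
  push_cast
  ring

theorem zeroMode_freePhase_dataVec (hk0 : ∀ j, k j ≠ 0) (N : ℕ) (A t : ℝ) :
    zeroMode (freePhase N 1 (t, 0) (dataVec hk A)) = 0 := by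
  rw [freePhase_dataVec, map_sum]
  refine Finset.sum_eq_zero fun j _ => ?_
  have h : (oneIdx (k j) (hk j)).freq = k j := rfl
  rw [map_smul, zeroMode_unitVec, zeroInd, h, if_neg (hk0 j), smul_zero]

/-- The sum of the phases of the tuples with frequency zero. -/
def phaseSum (k : J → Fin d → ℤ) (σ N : ℕ) (t : ℝ) : ℂ :=
  ∑ l : Tup J σ, (if Tup.alt k σ l = 0 then 1 else 0) * Complex.exp (-Complex.I *
    ((N : ℝ) ^ 2 / 2 * t * ((Tup.alt (fun j => ∑ l, k j l ^ 2) σ l : ℤ) : ℝ) : ℝ))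

theorem zeroMode_oddPower (σ N : ℕ) (A t : ℝ) :
    zeroMode (oddPower Idx.conj σ (freePhase N 1 (t, 0) (dataVec hk A)))
      = (A : ℂ) ^ (2 * σ + 1) * phaseSum k σ N t := by
  rw [freePhase_dataVec, oddPower_sum, map_sum, phaseSum, Finset.mul_sum]
  refine Finset.sum_congr rfl fun l _ => ?_
  rw [map_smul, zeroMode_unitVec, zeroInd, Tup.freq_idx, smul_eq_mul]
  change _ * (if Tup.alt k σ l = 0 then (1 : ℂ) else 0) = _
  ring

/-- Once the first factor is restricted to frequency zero, the product has frequency zero only if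
the second factor does. -/
theorem zeroMode_conv_diag (w v : L1 (Idx d K)) :
    zeroMode (conv (diag zeroInd w) v) = zeroMode w * zeroMode v := by
  have h : (ContinuousLinearMap.compL ℂ (L1 (Idx d K)) (L1 (Idx d K)) ℂ zeroMode).comp
      (conv.comp (diag zeroInd))
      = (ContinuousLinearMap.mul ℂ ℂ).bilinearComp zeroMode zeroMode := by
    refine L1.bilin_ext fun i j => ?_
    change zeroMode (conv (diag zeroInd (unitVec i)) (unitVec j))
      = zeroMode (unitVec i) * zeroMode (unitVec j)
    rw [diag_unitVec norm_zeroInd_le, map_smul, smul_apply, conv_unitVec, map_smul,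
      zeroMode_unitVec, zeroMode_unitVec, zeroMode_unitVec, smul_eq_mul]
    simp only [zeroInd, Idx.freq_add]
    split_ifs <;> simp_all
  exact DFunLike.congr_fun (DFunLike.congr_fun h w) v

/-- The mass term is a scalar multiple of the function in physical space, so it contributes nothing
to the mean when the mean is zero. The free evolution of the data has mean zero. -/
theorem zeroMode_renormalizedPower {v : L1 (Idx d K)} (hv : zeroMode v = 0) :
    zeroMode (renormalizedPower v) = zeroMode (oddPower Idx.conj 1 v) := by
  rw [renormalizedPower, map_add, map_smul, massTerm, zeroMode_conv_diag, hv, mul_zero, smul_zero,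
    add_zero]

/-- The zero Fourier mode of the solution with data `A ∑ⱼ e^{i N kⱼ · x}`, up to an error of second
order in time. -/
theorem exists_solution (hk : ∀ j l, |k j l| ≤ K) (hk0 : ∀ j, k j ≠ 0) {σ : ℕ} {C : ℝ} (hC : 0 < C)
    {F : L1 (Idx d K) → L1 (Idx d K)} (hF : IsAdmissible Idx.deg σ C F) {μ : ℂ}
    (hF0 : ∀ v, zeroMode v = 0 → zeroMode (F v) = μ * zeroMode (oddPower Idx.conj σ v))
    {N : ℕ} (hN : N ≠ 0) {Φ : SmoothTorus d → (Fin d → ℝ) → ℂ}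
    (hΦ : ∀ b x, Φ (synth N b) x = evalAt N x (F (degScale Idx.deg (1 / 2) b)))
    {A τ : ℝ} (hA : 0 < A) (hτ : 0 < τ) {m : ℝ} (hm : 0 < m) (hJ : Fintype.card J ≤ m)
    (hτA : C * 2 ^ (2 * σ + 1) * (m * (4 * A)) ^ (2 * σ) * τ ≤ 1) :
    ∃ ψ : ℝ → SmoothTorus d, IsSmoothSolution Φ (Set.Ioo (-τ) τ) ψ ∧
      (∀ x, ψ 0 x = ∑ j, (A : ℂ) * Complex.exp (Complex.I * (∑ l, N * (k j l : ℝ) * x l : ℝ))) ∧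
      ContinuousOn (fun t => distFourierCoeff (toDistribution (ψ t)) 0) (Set.Ioo (-τ) τ) ∧
      ∀ t ∈ Set.Ico 0 τ, ‖distFourierCoeff (toDistribution (ψ t)) 0
          + Complex.I * (μ * ((A : ℂ) ^ (2 * σ + 1) * ∫ u in (0 : ℝ)..t, phaseSum k σ N u))‖
        ≤ C ^ 2 * (2 * (m * (4 * A))) ^ (4 * σ + 1) * t ^ 2 := by
  have h4 : (0 : ℝ) ≤ 1 / 4 := by norm_num
  have h41 : (1 / 4 : ℝ) ≤ 1 := by norm_num
  -- The data have degree one, so amplitude `4 A` compensates the weight `1/4` of the field.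
  have hx₀ : ‖dataVec hk (4 * A)‖ ≤ m * (4 * A) :=
    (norm_dataVec_le hk (by positivity)).trans (mul_le_mul_of_nonneg_right hJ (by positivity))
  obtain ⟨a, ha0, ha, hest⟩ := exists_interaction_solution (θ := planePhase N) hF hC (1, 0)
    (by positivity) hx₀ hτ hτA
  have hdata : degScale Idx.deg (1 / 4) (dataVec hk (4 * A)) = dataVec hk A := by
    rw [degScale_dataVec hk _ h4 h41]
    congr 1
    ring
  refine ⟨field N a, isSmoothSolution_field hF hΦ hτ ha, fun x => ?_, ?_, fun t ht => ?_⟩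
  · rw [field_apply, ha0, phase_comp_degScale (by norm_num) (by norm_num) (by norm_num)
      (by norm_num)]
    have h : freePhase N (1 / 2 * (1 / 2)) (0, x) (dataVec hk (4 * A))
        = freePhase N 1 (0, x) (dataVec hk A) := by
      rw [← hdata, phase_comp_degScale zero_le_one le_rfl h4 h41]
      norm_num
    rw [h, ← evalAt_eq, dataVec, map_sum]
    refine Finset.sum_congr rfl fun j _ => ?_
    rw [map_smul, evalAt_unitVec, smul_eq_mul]
    rfl
  · simp only [distFourierCoeff_field_zero hN]
    have h : ContinuousOn a (Set.Ioo (-τ) τ) := fun t ht =>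
      (ha t ht).continuousAt.continuousWithinAt
    exact (zeroMode.comp (degScale Idx.deg (1 / 4))).continuous.comp_continuousOn h
  · set Z : L1 (Idx d K) →L[ℂ] ℂ := zeroMode.comp (degScale Idx.deg (1 / 4)) with hZ
    have hZn : ∀ w, ‖Z w‖ ≤ ‖w‖ := by
      intro w
      have h1 := norm_l1Lift_apply_le (norm_zeroInd_le (d := d) (K := K))
        (degScale Idx.deg (1 / 4) w)
      have h2 := norm_diag_apply_le (norm_pow_deg_le (Idx.deg (d := d) (K := K)) h4 h41) w
      rw [one_mul] at h1 h2
      exact h1.trans h2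
    have hZ0 : Z (dataVec hk (4 * A)) = 0 := by
      have h := zeroMode_freePhase_dataVec hk hk0 N A 0
      rw [zeroMode_degScale_phase N zero_le_one le_rfl, degScale_dataVec hk _ zero_le_one le_rfl,
        one_mul] at h
      rw [hZ, ContinuousLinearMap.comp_apply, hdata, h]
    -- The weight in `Z` passes through `F` and turns amplitude `4 A` into `A`, so the first Picard
    -- iterate is computed with the actual data.
    have hZG : ∀ u, Z (interaction Idx.deg (planePhase N) (1, 0) F u (dataVec hk (4 * A)))
        = -Complex.I * (μ * ((A : ℂ) ^ (2 * σ + 1) * phaseSum k σ N u)) := by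
      intro u
      have hte : u • ((1, 0) : ℝ × (Fin d → ℝ)) = (u, 0) := by simp
      have hte' : -u • ((1, 0) : ℝ × (Fin d → ℝ)) = (-u, 0) := by simp
      rw [hZ, ContinuousLinearMap.comp_apply, interaction, map_smul, map_smul, hte, hte',
        degScale_phase h4 h41 zero_le_one le_rfl, mul_one, zeroMode_degScale_phase N h4 h41,
        ← hF.map_degScale _ h4 h41, degScale_phase h4 h41 zero_le_one le_rfl, mul_comm (1 / 4 : ℝ),
        ← phase_comp_degScale zero_le_one le_rfl h4 h41, hdata,
        hF0 _ (zeroMode_freePhase_dataVec hk hk0 N A u), zeroMode_oddPower, smul_eq_mul]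
    have hcont := continuous_interaction (θ := planePhase N) hF (1, 0) (dataVec hk (4 * A))
    have hinteg := Z.intervalIntegral_comp_comm (μ := MeasureTheory.volume) (a := 0) (b := t)
      (hcont.intervalIntegrable _ _)
    simp only [hZG, intervalIntegral.integral_const_mul] at hinteg
    have h := (hZn _).trans (hest t ht)
    rw [map_sub, map_sub, hZ0, sub_zero, ← hinteg] at h
    rw [distFourierCoeff_field_zero hN]
    rw [neg_mul, sub_neg_eq_add] at h
    exact h

end Data

/-! ### Fourier-Lebesgue norms: lower bound by the zero mode, upper bound for the data. -/

section Norms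
variable {d : ℕ}

/-- The weight `⟨0⟩^r` equals `1`, and every `ℓ^p` norm dominates a single coordinate. -/
theorem enorm_distFourierCoeff_zero_le (r : ℝ) (p : ℝ≥0∞) [hp : Fact (1 ≤ p)]
    (u : TorusDistribution d) : ‖distFourierCoeff u 0‖ₑ ≤ flENorm r p u := by
  refine le_iInf fun h => ?_
  have hp0 : p ≠ 0 := (zero_lt_one.trans_le hp.out).ne'
  have h1 := lp.norm_apply_le_norm hp0 (FL.toLp d r p ⟨u, h⟩) 0
  have h2 : (FL.toLp d r p ⟨u, h⟩ : (Fin d → ℤ) → ℂ) 0 = distFourierCoeff u 0 := by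
    change weightedCoeff r u 0 = _
    simp [weightedCoeff]
  rw [h2] at h1
  exact enorm_le_iff_norm_le.2 h1

/-- By continuity, the times at which the zero mode exceeds `M` form an open set. If nonempty it
would have positive measure, contradicting the essential bound. -/
theorem norm_le_of_timeSupNorm_le {r : ℝ} {p : ℝ≥0∞} [Fact (1 ≤ p)] {T : ℝ} {J : Set ℝ}
    (hJ : IsOpen J) {ψ : ℝ → SmoothTorus d} {M : ℝ≥0} (h : timeSupNorm r p T J ψ ≤ M)
    (hc : ContinuousOn (fun t => distFourierCoeff (toDistribution (ψ t)) 0) J) {t : ℝ}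
    (ht : t ∈ Set.Ioo 0 T ∩ J) : ‖distFourierCoeff (toDistribution (ψ t)) 0‖ ≤ M := by
  by_contra! hlt
  set f := fun t => ‖distFourierCoeff (toDistribution (ψ t)) 0‖
  have hopen : IsOpen (Set.Ioo 0 T ∩ J) := isOpen_Ioo.inter hJ
  have hcf : ContinuousOn f (Set.Ioo 0 T ∩ J) := (hc.mono Set.inter_subset_right).norm
  have hO : IsOpen ((Set.Ioo 0 T ∩ J) ∩ f ⁻¹' Set.Ioi (M : ℝ)) :=
    hcf.isOpen_inter_preimage hopen isOpen_Ioi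
  have hpos := hO.measure_pos MeasureTheory.volume ⟨t, ht, hlt⟩
  have hae : ∀ᵐ τ ∂(MeasureTheory.volume.restrict (Set.Ioo 0 T ∩ J)), f τ ≤ M := by
    filter_upwards [ENNReal.ae_le_essSup (μ := MeasureTheory.volume.restrict (Set.Ioo 0 T ∩ J))
      (fun t => flENorm r p (toDistribution (ψ t)))] with τ hτ
    have h1 := (enorm_distFourierCoeff_zero_le r p _).trans (hτ.trans h)
    have h2 : ‖distFourierCoeff (toDistribution (ψ τ)) 0‖₊ ≤ M := by exact_mod_cast h1
    exact_mod_cast h2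
  rw [MeasureTheory.ae_restrict_iff' hopen.measurableSet] at hae
  refine hpos.ne' (MeasureTheory.measure_mono_null (fun τ hτ => ?_) hae)
  intro h'
  exact absurd (h' hτ.1) (not_le.2 hτ.2)

variable {J : Type} [Fintype J]

theorem distFourierCoeff_of_eq_sum {f : SmoothTorus d} {k : J → Fin d → ℤ} {A : ℂ}
    (hf : ∀ x, f x = ∑ j, A * Complex.exp (Complex.I * (∑ l, (k j l : ℝ) * x l : ℝ)))
    (n : Fin d → ℤ) :
    distFourierCoeff (toDistribution f) n = ∑ j, if n = k j then A else 0 := by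
  rw [distFourierCoeff_toDistribution]
  have h1 : ∀ x, f x * Complex.exp (Complex.I * (∑ l, ((-n) l : ℝ) * x l : ℝ))
      = ∑ j, A * Complex.exp (Complex.I * (∑ l, ((k j - n) l : ℤ) * x l : ℝ)) := by
    intro x
    rw [hf, Finset.sum_mul]
    refine Finset.sum_congr rfl fun j _ => ?_
    rw [mul_assoc, ← Complex.exp_add, ← mul_add, ← Complex.ofReal_add, ← Finset.sum_add_distrib]
    congr 4
    refine Finset.sum_congr rfl fun l _ => ?_
    simp
    ring
  simp only [h1]
  rw [MeasureTheory.integral_finsetSum _ fun j _ => integrableOn_cell (by fun_prop),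
    Finset.mul_sum]
  refine Finset.sum_congr rfl fun j _ => ?_
  rw [MeasureTheory.integral_const_mul, integral_cell_exp]
  simp only [sub_eq_zero, eq_comm (a := n)]
  split_ifs
  · field_simp [two_pi_pow_ne_zero (d := d)]
  · simp

/-- A single mode has the same `ℓ^p` norm for every `p`, so the triangle inequality gives a bound
uniform in `p`, even when frequencies coincide. -/
theorem exists_FL_of_eq_sum (s : ℝ) (p : ℝ≥0∞) [hp : Fact (1 ≤ p)] {f : SmoothTorus d}
    {k : J → Fin d → ℤ} {A B : ℝ} (hA : 0 ≤ A)
    (hf : ∀ x, f x = ∑ j, (A : ℂ) * Complex.exp (Complex.I * (∑ l, (k j l : ℝ) * x l : ℝ)))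
    (hB : ∀ j, √(1 + ∑ l, (k j l : ℝ) ^ 2) ^ s ≤ B) :
    ∃ u : FL d s p, (u : TorusDistribution d) = toDistribution f ∧
      ‖u‖ ≤ Fintype.card J * (B * A) := by
  set g : lp (fun _ : Fin d → ℤ => ℂ) p :=
    ∑ j, lp.single p (k j) ((√(1 + ∑ l, (k j l : ℝ) ^ 2) ^ s * A : ℝ) : ℂ) with hg
  have hw : weightedCoeff s (toDistribution f) = g := by
    funext n
    rw [hg, lp.coeFn_sum, Finset.sum_apply, weightedCoeff, distFourierCoeff_of_eq_sum hf,
      Finset.mul_sum]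
    refine Finset.sum_congr rfl fun j _ => ?_
    rw [lp.single_apply, Pi.single_apply]
    split_ifs with h
    · rw [h]
      push_cast
      rfl
    · simp
  have hmem : toDistribution f ∈ FL d s p := by
    change Memℓp (weightedCoeff s (toDistribution f)) p
    rw [hw]
    exact lp.memℓp g
  refine ⟨⟨toDistribution f, hmem⟩, rfl, ?_⟩
  have hn : ‖(⟨toDistribution f, hmem⟩ : FL d s p)‖ = ‖g‖ := by
    change ‖FL.toLp d s p ⟨toDistribution f, hmem⟩‖ = ‖g‖
    congr 1
    exact lp.ext hw
  rw [hn, hg]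
  refine (norm_sum_le_of_le _ fun j _ => ?_).trans_eq
    (by rw [Finset.sum_const, Finset.card_univ, nsmul_eq_mul])
  rw [lp.norm_single (zero_lt_one.trans_le hp.out), Complex.norm_real,
    Real.norm_of_nonneg (by positivity)]
  exact mul_le_mul_of_nonneg_right (hB j) hA

theorem weight_le {s : ℝ} (hs : s ≤ 0) {N : ℕ} (hN : N ≠ 0) {k : Fin d → ℤ} (hk : k ≠ 0) :
    √(1 + ∑ l, (((N : ℤ) * k l : ℤ) : ℝ) ^ 2) ^ s ≤ (N : ℝ) ^ s := by
  obtain ⟨l, hl⟩ := Function.ne_iff.1 hk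
  have hN' : (0 : ℝ) < N := by exact_mod_cast Nat.pos_of_ne_zero hN
  refine Real.rpow_le_rpow_of_nonpos hN' (Real.le_sqrt_of_sq_le ?_) hs
  have h1 : (1 : ℝ) ≤ (k l : ℝ) ^ 2 := by
    have : 1 ≤ |k l| := Int.one_le_abs hl
    rw [← sq_abs]
    have h : (1 : ℝ) ≤ |(k l : ℝ)| := by exact_mod_cast this
    nlinarith
  have h2 : (((N : ℤ) * k l : ℤ) : ℝ) ^ 2 ≤ ∑ l, (((N : ℤ) * k l : ℤ) : ℝ) ^ 2 :=
    Finset.single_le_sum (f := fun l => (((N : ℤ) * k l : ℤ) : ℝ) ^ 2)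
      (fun l _ => sq_nonneg _) (Finset.mem_univ l)
  push_cast at h2 ⊢
  nlinarith [sq_nonneg (N : ℝ)]

end Norms

/-! ### Consequences of an a priori estimate, and lower bounds for the phase integral. -/

section Inflation
variable {d K : ℕ} {J : Type} [Fintype J] {k : J → Fin d → ℤ}

/-- An a priori estimate near zero controls the zero mode generated by the data
`A ∑ⱼ e^{i N kⱼ · x}`, up to an error of second order in time. -/
theorem zeroMode_bound_of_aprioriEstimate (hk : ∀ j l, |k j l| ≤ K) (hk0 : ∀ j, k j ≠ 0) {σ : ℕ}
    {C : ℝ} (hC : 0 < C) {F : L1 (Idx d K) → L1 (Idx d K)} (hF : IsAdmissible Idx.deg σ C F) {μ : ℂ}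
    (hμ : ‖μ‖ = 1)
    (hF0 : ∀ v, zeroMode v = 0 → zeroMode (F v) = μ * zeroMode (oddPower Idx.conj σ v))
    {Φ : SmoothTorus d → (Fin d → ℝ) → ℂ}
    (hΦ : ∀ N : ℕ, N ≠ 0 → ∀ b x,
      Φ (synth N b) x = evalAt N x (F (degScale Idx.deg (1 / 2) b)))
    {s : ℝ} (hs : s ≤ 0) {p₁ p₂ : ℝ≥0∞} [Fact (1 ≤ p₁)] [Fact (1 ≤ p₂)] {r T : ℝ}
    {U : Set (FL d s p₁)} (hU : U ∈ 𝓝 0) {M : ℝ≥0 → ℝ≥0} (hM : Continuous M)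
    (h : AprioriEstimate Φ s p₁ r p₂ T U M) :
    ∃ ε > 0, ∃ Λ C₁ C₂ : ℝ, 0 < C₁ ∧ 0 < C₂ ∧ ∀ (N : ℕ) (A t : ℝ), N ≠ 0 → 0 < A → 0 < t → t < T →
      (N : ℝ) ^ s * A < ε → C₁ * A ^ (2 * σ) * t ≤ 1 →
      A ^ (2 * σ + 1) * ‖∫ u in (0 : ℝ)..t, phaseSum k σ N u‖
        ≤ Λ + C₂ * A ^ (4 * σ + 1) * t ^ 2 := by
  have hM' : ∀ᶠ u : FL d s p₁ in 𝓝 0, M ‖u‖₊ < M 0 + 1 := by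
    have h1 : Continuous fun u : FL d s p₁ => M ‖u‖₊ := hM.comp continuous_nnnorm
    refine h1.continuousAt.eventually_lt continuousAt_const ?_
    simp
  obtain ⟨ε, hε, hball⟩ := Metric.eventually_nhds_iff.1 (hM'.and hU)
  -- The added `1` keeps `m` positive even for empty `J`.
  set m : ℝ := Fintype.card J + 1 with hm
  have hm0 : 0 < m := by positivity
  have hmJ : (Fintype.card J : ℝ) ≤ m := by rw [hm]; linarith
  refine ⟨ε / m, by positivity, M 0 + 1, C * 2 ^ (2 * σ + 1) * (m * 4) ^ (2 * σ) * 2,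
    C ^ 2 * (2 * (m * 4)) ^ (4 * σ + 1), by positivity, by positivity, ?_⟩
  intro N A t hN hA ht htT hNA hCA
  -- The lifespan `2 t` puts `t` inside the time interval; it accounts for the last factor `2` in
  -- `C₁`.
  obtain ⟨ψ, hψ, hψ0, hcont, hest⟩ := exists_solution hk hk0 hC hF hF0 hN (hΦ N hN) hA
    (τ := 2 * t) (by positivity) hm0 hmJ (by
      refine le_trans (le_of_eq ?_) hCA
      simp only [mul_pow]
      ring)
  obtain ⟨u, hu, hun⟩ := exists_FL_of_eq_sum s p₁ (f := ψ 0)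
    (k := fun j l => (N : ℤ) * k j l) hA.le (fun x => by rw [hψ0]; push_cast; rfl)
    (fun j => weight_le hs hN (hk0 j))
  have hun' : ‖u‖ < ε := by
    have hNs : 0 ≤ (N : ℝ) ^ s * A := by positivity
    calc ‖u‖ ≤ Fintype.card J * ((N : ℝ) ^ s * A) := hun
      _ ≤ m * ((N : ℝ) ^ s * A) := mul_le_mul_of_nonneg_right hmJ hNs
      _ < m * (ε / m) := mul_lt_mul_of_pos_left hNA hm0
      _ = ε := by field_simp
  obtain ⟨h1, h2⟩ := hball (y := u) (by rwa [dist_zero_right])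
  have h3 := h _ ψ hψ u h2 hu
  have ht2 : t ∈ Set.Ioo 0 T ∩ Set.Ioo (-(2 * t)) (2 * t) :=
    ⟨⟨ht, htT⟩, by constructor <;> linarith⟩
  have h4 := norm_le_of_timeSupNorm_le isOpen_Ioo h3 hcont ht2
  have h5 := hest t ⟨ht.le, by linarith⟩
  have h6 : (M ‖u‖₊ : ℝ) ≤ M 0 + 1 := by exact_mod_cast h1.le
  set z := distFourierCoeff (toDistribution (ψ t)) 0
  set I := ∫ u in (0 : ℝ)..t, phaseSum k σ N u
  have h7 : ‖Complex.I * (μ * ((A : ℂ) ^ (2 * σ + 1) * I))‖ = A ^ (2 * σ + 1) * ‖I‖ := by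
    rw [norm_mul, norm_mul, norm_mul, norm_pow, Complex.norm_I, hμ, one_mul, one_mul,
      Complex.norm_real, Real.norm_of_nonneg hA.le]
  have h8 : A ^ (2 * σ + 1) * ‖I‖ ≤ ‖z + Complex.I * (μ * ((A : ℂ) ^ (2 * σ + 1) * I))‖ + ‖z‖ := by
    rw [← h7]
    have := norm_sub_le (z + Complex.I * (μ * ((A : ℂ) ^ (2 * σ + 1) * I))) z
    rwa [add_sub_cancel_left] at this
  have h9 : C ^ 2 * (2 * (m * (4 * A))) ^ (4 * σ + 1) * t ^ 2
      = C ^ 2 * (2 * (m * 4)) ^ (4 * σ + 1) * A ^ (4 * σ + 1) * t ^ 2 := by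
    rw [mul_assoc (C ^ 2) _ (A ^ _), ← mul_pow]
    ring_nf
  rw [h9] at h5
  linarith

theorem norm_integral_exp_le {ν : ℝ} (hν : ν ≠ 0) (t : ℝ) :
    ‖∫ u in (0 : ℝ)..t, Complex.exp (-Complex.I * (ν * u : ℝ))‖ ≤ 2 / |ν| := by
  have h1 : -Complex.I * (ν : ℂ) ≠ 0 :=
    mul_ne_zero (neg_ne_zero.2 Complex.I_ne_zero) (by exact_mod_cast hν)
  have h2 : (fun u : ℝ => Complex.exp (-Complex.I * (ν * u : ℝ)))
      = fun u : ℝ => Complex.exp (-Complex.I * (ν : ℂ) * u) := by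
    funext u
    push_cast
    rw [mul_assoc]
  have h3 : ∀ u : ℝ, ‖Complex.exp (-Complex.I * (ν : ℂ) * u)‖ = 1 := fun u => by
    have : -Complex.I * (ν : ℂ) * u = ((-(ν * u) : ℝ) : ℂ) * Complex.I := by push_cast; ring
    rw [this, Complex.norm_exp_ofReal_mul_I]
  rw [h2, integral_exp_mul_complex h1, norm_div, norm_mul, norm_neg, Complex.norm_I, one_mul,
    Complex.norm_real, Real.norm_eq_abs]
  gcongr
  refine (norm_sub_le _ _).trans ?_
  rw [h3, h3]
  norm_num

theorem continuous_phaseSum (σ N : ℕ) : Continuous (phaseSum k σ N) := by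
  unfold phaseSum
  fun_prop

/-- Each resonant tuple contributes exactly `t`, so no cancellation occurs among them. A nonresonant
one has a nonzero integer phase, hence oscillates at frequency at least `N²/2` and contributes at
most `4/N²`. -/
theorem phaseSum_integral_lower_of_resonant {σ : ℕ} (l₀ : Tup J σ) (hl₀ : Tup.alt k σ l₀ = 0)
    (hr₀ : Tup.alt (fun j => ∑ l, k j l ^ 2) σ l₀ = 0) {N : ℕ} (hN : N ≠ 0) {t : ℝ} (ht : 0 ≤ t) :
    t - Fintype.card (Tup J σ) * (4 / (N : ℝ) ^ 2) ≤ ‖∫ u in (0 : ℝ)..t, phaseSum k σ N u‖ := by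
  classical
  have hN' : (0 : ℝ) < (N : ℝ) ^ 2 := by positivity
  set w : Tup J σ → ℤ := Tup.alt (fun j => ∑ l, k j l ^ 2) σ
  have hterm : ∀ l, (if l = l₀ then t else 0) - 4 / (N : ℝ) ^ 2
      ≤ (∫ u in (0 : ℝ)..t, (if Tup.alt k σ l = 0 then (1 : ℂ) else 0) *
        Complex.exp (-Complex.I * ((N : ℝ) ^ 2 / 2 * u * (w l : ℝ) : ℝ))).re := by
    intro l
    have hpos : 0 ≤ 4 / (N : ℝ) ^ 2 := by positivity
    by_cases hl : Tup.alt k σ l = 0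
    · simp only [if_pos hl, one_mul]
      by_cases hw : w l = 0
      · simp only [hw, Int.cast_zero, mul_zero, Complex.ofReal_zero, Complex.exp_zero]
        rw [intervalIntegral.integral_const, sub_zero, Complex.real_smul, mul_one,
          Complex.ofReal_re]
        split_ifs <;> linarith
      · have hne : l ≠ l₀ := fun h => hw (by rw [h]; exact hr₀)
        rw [if_neg hne, zero_sub]
        have hν : (N : ℝ) ^ 2 / 2 * (w l : ℝ) ≠ 0 :=
          mul_ne_zero (by positivity) (by exact_mod_cast hw)
        have h1 := norm_integral_exp_le hν t
        have h2 : 2 / |(N : ℝ) ^ 2 / 2 * (w l : ℝ)| ≤ 4 / (N : ℝ) ^ 2 := by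
          have h3 : (1 : ℝ) ≤ |(w l : ℝ)| := by exact_mod_cast Int.one_le_abs hw
          rw [abs_mul, abs_of_pos (by positivity : (0 : ℝ) < (N : ℝ) ^ 2 / 2),
            div_le_div_iff₀ (by positivity) hN']
          nlinarith
        have h4 : ∀ u : ℝ, (N : ℝ) ^ 2 / 2 * u * (w l : ℝ) = (N : ℝ) ^ 2 / 2 * (w l : ℝ) * u :=
          fun u => by ring
        simp only [h4]
        exact neg_le_of_abs_le ((Complex.abs_re_le_norm _).trans (h1.trans h2))
    · have hne : l ≠ l₀ := fun h => hl (by rw [h]; exact hl₀)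
      simp only [if_neg hl, if_neg hne, zero_mul, intervalIntegral.integral_zero, Complex.zero_re]
      linarith
  refine le_trans ?_ (Complex.re_le_norm _)
  have hinteg : ∫ u in (0 : ℝ)..t, phaseSum k σ N u
      = ∑ l, ∫ u in (0 : ℝ)..t, (if Tup.alt k σ l = 0 then (1 : ℂ) else 0) *
        Complex.exp (-Complex.I * ((N : ℝ) ^ 2 / 2 * u * (w l : ℝ) : ℝ)) :=
    intervalIntegral.integral_finsetSum fun l _ => Continuous.intervalIntegrable (by fun_prop) _ _
  rw [hinteg, Complex.re_sum]
  refine le_trans (le_of_eq ?_) (Finset.sum_le_sum fun l _ => hterm l)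
  rw [Finset.sum_sub_distrib, Finset.sum_ite_eq', if_pos (Finset.mem_univ _), Finset.sum_const,
    Finset.card_univ, nsmul_eq_mul]

/-- Up to time `c/N²` all phases stay below one radian. All terms then have nonnegative real part,
and that of `l₀` is at least `1/2`; no resonance is needed. -/
theorem phaseSum_integral_lower_of_short {σ : ℕ} (l₀ : Tup J σ) (hl₀ : Tup.alt k σ l₀ = 0) :
    ∃ c > 0, ∀ N : ℕ, N ≠ 0 →
      c / (N : ℝ) ^ 2 / 2 ≤ ‖∫ u in (0 : ℝ)..(c / (N : ℝ) ^ 2), phaseSum k σ N u‖ := by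
  set w : Tup J σ → ℤ := Tup.alt (fun j => ∑ l, k j l ^ 2) σ
  set R : ℝ := ∑ l, |(w l : ℝ)| with hR
  have hR0 : 0 ≤ R := Finset.sum_nonneg fun l _ => abs_nonneg _
  have hwR : ∀ l, |(w l : ℝ)| ≤ R := fun l =>
    Finset.single_le_sum (f := fun l => |(w l : ℝ)|) (fun l _ => abs_nonneg _) (Finset.mem_univ l)
  refine ⟨1 / (R + 1), by positivity, fun N hN => ?_⟩
  have hN' : (0 : ℝ) < (N : ℝ) ^ 2 := by positivity
  set t := 1 / (R + 1) / (N : ℝ) ^ 2 with ht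
  have ht0 : 0 ≤ t := by positivity
  have hre : ∀ u ∈ Set.Icc 0 t, 1 / 2 ≤ (phaseSum k σ N u).re := by
    intro u hu
    have hcos : ∀ l, 1 / 2 ≤ (Complex.exp (-Complex.I *
        ((N : ℝ) ^ 2 / 2 * u * (w l : ℝ) : ℝ))).re := by
      intro l
      set y := (N : ℝ) ^ 2 / 2 * u * (w l : ℝ) with hy
      have h1 : |y| ≤ 1 := by
        rw [hy, abs_mul, abs_of_nonneg (mul_nonneg (by positivity) hu.1)]
        have h2 : (N : ℝ) ^ 2 / 2 * u ≤ 1 / (R + 1) / 2 := by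
          calc (N : ℝ) ^ 2 / 2 * u ≤ (N : ℝ) ^ 2 / 2 * t := by gcongr; exact hu.2
            _ = 1 / (R + 1) / 2 := by rw [ht]; field_simp
        calc (N : ℝ) ^ 2 / 2 * u * |(w l : ℝ)| ≤ 1 / (R + 1) / 2 * R :=
              mul_le_mul h2 (hwR l) (abs_nonneg _) (by positivity)
          _ ≤ 1 := by
            rw [div_div, one_div_mul_eq_div, div_le_one (by positivity)]
            linarith
      have h2 : -Complex.I * (y : ℂ) = ((-y : ℝ) : ℂ) * Complex.I := by push_cast; ring
      rw [h2, Complex.exp_ofReal_mul_I_re, Real.cos_neg]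
      have h3 := Real.one_sub_sq_div_two_le_cos (x := y)
      have h4 : y ^ 2 ≤ 1 := by
        rw [← sq_abs]
        exact pow_le_one₀ (abs_nonneg _) h1
      linarith
    have hterm : ∀ l, 0 ≤ ((if Tup.alt k σ l = 0 then (1 : ℂ) else 0) * Complex.exp (-Complex.I *
        ((N : ℝ) ^ 2 / 2 * u * (w l : ℝ) : ℝ))).re := by
      intro l
      have := hcos l
      split_ifs
      · rw [one_mul]
        linarith
      · rw [zero_mul, Complex.zero_re]
    rw [phaseSum, Complex.re_sum]
    refine le_trans ?_ (Finset.single_le_sum (fun l _ => hterm l) (Finset.mem_univ l₀))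
    rw [if_pos hl₀, one_mul]
    exact hcos l₀
  refine le_trans ?_ (Complex.re_le_norm _)
  have hcont := continuous_phaseSum (k := k) σ N
  have h1 := Complex.reCLM.intervalIntegral_comp_comm (μ := MeasureTheory.volume) (a := 0) (b := t)
    (hcont.intervalIntegrable _ _)
  have h2 : t / 2 = ∫ _ in (0 : ℝ)..t, (1 / 2 : ℝ) := by
    rw [intervalIntegral.integral_const, smul_eq_mul]
    ring
  rw [← Complex.reCLM_apply, ← h1, h2]
  exact intervalIntegral.integral_mono_on ht0 (by simp)
    ((Complex.reCLM.continuous.comp hcont).intervalIntegrable _ _) hre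

end Inflation

/-! ### Choice of parameters and contradiction in the two regimes. -/

section Conclusion

/-- `Φ` is, on the Fourier side, a nonlinearity whose effect on the zero mode of a function of mean
zero is that of `μ |ψ|^{2σ} ψ`. -/
def IsPowerLike {d : ℕ} (Φ : SmoothTorus d → (Fin d → ℝ) → ℂ) (σ : ℕ) : Prop :=
  ∀ K : ℕ, ∃ (F : L1 (Idx d K) → L1 (Idx d K)) (C : ℝ) (μ : ℂ), 0 < C ∧
    IsAdmissible Idx.deg σ C F ∧ ‖μ‖ = 1 ∧
    (∀ v, zeroMode v = 0 → zeroMode (F v) = μ * zeroMode (oddPower Idx.conj σ v)) ∧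
    ∀ N : ℕ, N ≠ 0 → ∀ b x, Φ (synth N b) x = evalAt N x (F (degScale Idx.deg (1 / 2) b))

theorem isPowerLike_nlsTerm (d σ : ℕ) {μ : ℝ} (hμ : |μ| = 1) :
    IsPowerLike (d := d) (nlsTerm μ σ) σ := by
  intro K
  have hμ' : ‖(μ : ℂ)‖ = 1 := by rw [Complex.norm_real, Real.norm_eq_abs, hμ]
  refine ⟨fun u => (μ : ℂ) • oddPower Idx.conj σ u, ‖(μ : ℂ)‖ * (2 * σ + 1), μ, ?_,
    (oddPower_isAdmissible Idx.deg_add Idx.deg_conj σ).smul (μ : ℂ), hμ', fun v _ => ?_,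
    fun N _ b x => nlsTerm_synth N σ μ b x⟩
  · rw [hμ']
    positivity
  · rw [map_smul, smul_eq_mul]

theorem isPowerLike_renormalizedTerm (d : ℕ) {μ : ℝ} (hμ : |μ| = 1) :
    IsPowerLike (d := d) (renormalizedTerm μ) 1 := by
  intro K
  have hμ' : ‖(μ : ℂ)‖ = 1 := by rw [Complex.norm_real, Real.norm_eq_abs, hμ]
  refine ⟨fun u => (μ : ℂ) • renormalizedPower u, ‖(μ : ℂ)‖ * 9, μ, ?_,
    renormalizedPower_isAdmissible.smul (μ : ℂ), hμ', fun v hv => ?_,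
    fun N hN b x => renormalizedTerm_synth hN μ b x⟩
  · rw [hμ']
    positivity
  · rw [map_smul, smul_eq_mul, zeroMode_renormalizedPower hv]

variable {d : ℕ} {J : Type} [Fintype J] {k : J → Fin d → ℤ}

/-- First `δ`, then `A`, then `t = δ A^{-2σ}` are fixed, and `N` is taken large last. The main term
is at least `¾ A δ` and the error at most `¼ A δ`, so `½ A δ ≤ Λ`, which fails for large `A`. -/
theorem not_aprioriEstimate_of_resonant {K : ℕ} (hk : ∀ j l, |k j l| ≤ K) (hk0 : ∀ j, k j ≠ 0)
    {σ : ℕ} (hσ : 1 ≤ σ) (l₀ : Tup J σ) (hl₀ : Tup.alt k σ l₀ = 0)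
    (hr₀ : Tup.alt (fun j => ∑ l, k j l ^ 2) σ l₀ = 0)
    {Φ : SmoothTorus d → (Fin d → ℝ) → ℂ} (hΦ : IsPowerLike Φ σ)
    {s : ℝ} (hs : s < 0) {p₁ p₂ : ℝ≥0∞} [Fact (1 ≤ p₁)] [Fact (1 ≤ p₂)] {r T : ℝ} (hT : 0 < T)
    {U : Set (FL d s p₁)} (hU : U ∈ 𝓝 0) {M : ℝ≥0 → ℝ≥0} (hM : Continuous M) :
    ¬ AprioriEstimate Φ s p₁ r p₂ T U M := by
  intro h
  obtain ⟨F, C, μ, hC, hF, hμ, hF0, hΦ'⟩ := hΦ K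
  obtain ⟨ε, hε, Λ, C₁, C₂, hC₁, hC₂, H⟩ := zeroMode_bound_of_aprioriEstimate hk hk0 hC hF hμ hF0
    hΦ' hs.le hU hM h
  set δ := min (1 / C₁) (1 / (4 * C₂))
  have hδ : 0 < δ := by positivity
  have hδ₁ : C₁ * δ ≤ 1 := by
    have : δ ≤ 1 / C₁ := min_le_left _ _
    rwa [le_div_iff₀ hC₁, mul_comm] at this
  have hδ₂ : C₂ * δ ≤ 1 / 4 := by
    have h1 : δ ≤ 1 / (4 * C₂) := min_le_right _ _
    rw [le_div_iff₀ (by positivity)] at h1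
    linarith
  -- The summands give, in order, `A ≤ A^{2σ}`, `t < T`, and the final contradiction.
  set A := 1 + δ / T + 4 * (|Λ| + 1) / δ with hA
  have hA1 : 1 ≤ A := by
    have : 0 ≤ δ / T + 4 * (|Λ| + 1) / δ := by positivity
    linarith
  have hA0 : 0 < A := by linarith
  have hAT : δ < A * T := by
    have h1 : 0 ≤ 4 * (|Λ| + 1) / δ := by positivity
    calc δ = δ / T * T := by field_simp
      _ < A * T := by gcongr; linarith
  have hAδ : 4 * (|Λ| + 1) ≤ A * δ := by
    have h1 : 0 ≤ δ / T := by positivity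
    calc 4 * (|Λ| + 1) = 4 * (|Λ| + 1) / δ * δ := by field_simp
      _ ≤ A * δ := by gcongr; linarith
  set t := δ / A ^ (2 * σ) with ht
  have ht0 : 0 < t := by positivity
  have hAt : A ^ (2 * σ) * t = δ := by rw [ht]; field_simp
  have htT : t < T := by
    rw [ht, div_lt_iff₀ (by positivity), mul_comm]
    refine hAT.trans_le (mul_le_mul_of_nonneg_right ?_ hT.le)
    exact le_self_pow₀ hA1 (by omega)
  have hev₁ : ∀ᶠ N : ℕ in Filter.atTop, (N : ℝ) ^ s * A < ε := by
    have h1 := ((tendsto_rpow_neg_atTop (neg_pos.2 hs)).comp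
      tendsto_natCast_atTop_atTop).mul_const A
    rw [zero_mul, neg_neg] at h1
    exact h1.eventually_lt_const hε
  have hev₂ : ∀ᶠ N : ℕ in Filter.atTop,
      (Fintype.card (Tup J σ) : ℝ) * (4 / (N : ℝ) ^ 2) < t / 4 := by
    have h1 : Filter.Tendsto (fun N : ℕ => (Fintype.card (Tup J σ) : ℝ) * (4 / (N : ℝ) ^ 2))
        Filter.atTop (𝓝 ((Fintype.card (Tup J σ) : ℝ) * 0)) :=
      ((tendsto_const_nhds.div_atTop ((Filter.tendsto_pow_atTop two_ne_zero).comp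
        tendsto_natCast_atTop_atTop))).const_mul _
    rw [mul_zero] at h1
    exact h1.eventually_lt_const (by positivity)
  obtain ⟨N, ⟨hN₁, hN₂⟩, hN⟩ := ((hev₁.and hev₂).and (Filter.eventually_ne_atTop 0)).exists
  have h1 := H N A t hN hA0 ht0 htT hN₁ (by rw [mul_assoc, hAt]; exact hδ₁)
  have h2 := phaseSum_integral_lower_of_resonant l₀ hl₀ hr₀ hN ht0.le
  have h3 : 3 / 4 * t ≤ ‖∫ u in (0 : ℝ)..t, phaseSum k σ N u‖ := by linarith
  have h4 : 3 / 4 * (A * δ) ≤ A ^ (2 * σ + 1) * ‖∫ u in (0 : ℝ)..t, phaseSum k σ N u‖ := by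
    calc 3 / 4 * (A * δ) = A ^ (2 * σ + 1) * (3 / 4 * t) := by rw [← hAt]; ring
      _ ≤ _ := mul_le_mul_of_nonneg_left h3 (by positivity)
  have h5 : C₂ * A ^ (4 * σ + 1) * t ^ 2 ≤ 1 / 4 * (A * δ) := by
    calc C₂ * A ^ (4 * σ + 1) * t ^ 2 = C₂ * (A ^ (2 * σ) * t) * (A * (A ^ (2 * σ) * t)) := by ring
      _ = C₂ * δ * (A * δ) := by rw [hAt]
      _ ≤ 1 / 4 * (A * δ) := mul_le_mul_of_nonneg_right hδ₂ (by positivity)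
  linarith [le_abs_self Λ, abs_nonneg Λ]

theorem not_aprioriEstimate_of_cubic {K : ℕ} (hk : ∀ j l, |k j l| ≤ K) (hk0 : ∀ j, k j ≠ 0)
    (l₀ : Tup J 1) (hl₀ : Tup.alt k 1 l₀ = 0)
    {Φ : SmoothTorus d → (Fin d → ℝ) → ℂ} (hΦ : IsPowerLike Φ 1)
    {s : ℝ} (hs : s < -2 / 3) {p₁ p₂ : ℝ≥0∞} [Fact (1 ≤ p₁)] [Fact (1 ≤ p₂)] {r T : ℝ} (hT : 0 < T)
    {U : Set (FL d s p₁)} (hU : U ∈ 𝓝 0) {M : ℝ≥0 → ℝ≥0} (hM : Continuous M) :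
    ¬ AprioriEstimate Φ s p₁ r p₂ T U M := by
  intro h
  obtain ⟨F, C, μ, hC, hF, hμ, hF0, hΦ'⟩ := hΦ K
  obtain ⟨ε, hε, Λ, C₁, C₂, hC₁, hC₂, H⟩ := zeroMode_bound_of_aprioriEstimate hk hk0 hC hF hμ hF0
    hΦ' (by linarith) hU hM h
  obtain ⟨c, hc, hlow⟩ := phaseSum_integral_lower_of_short (k := k) l₀ hl₀
  -- With `A = N^a` and `t = c N^{-2}`: `a > 2/3` makes `A³ t` unbounded, `a < 1` makes `A² t`
  -- small, as the lifespan and the error require, and `a < -s` makes the data small.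
  obtain ⟨a, ha, ha'⟩ : ∃ a : ℝ, 2 / 3 < a ∧ a < min 1 (-s) :=
    exists_between (lt_min (by norm_num) (by linarith))
  obtain ⟨ha1, has⟩ := lt_min_iff.1 ha'
  have hneg : ∀ b : ℝ, b < 0 → Filter.Tendsto (fun N : ℕ => (N : ℝ) ^ b) Filter.atTop (𝓝 0) := by
    intro b hb
    have h1 := (tendsto_rpow_neg_atTop (neg_pos.2 hb)).comp
      (tendsto_natCast_atTop_atTop (R := ℝ))
    rwa [neg_neg] at h1
  have hev₁ := (hneg (s + a) (by linarith)).eventually_lt_const hε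
  have hev₂ := ((hneg (2 * a - 2) (by linarith)).const_mul (C₁ * c)).eventually_lt_const
    (show C₁ * c * 0 < 1 by norm_num)
  have hev₃ := ((hneg (-2) (by norm_num)).const_mul c).eventually_lt_const
    (show c * 0 < T by simpa using hT)
  have hev₄ := ((hneg (2 * a - 2) (by linarith)).const_mul (C₂ * c)).eventually_lt_const
    (show C₂ * c * 0 < 1 / 4 by norm_num)
  have hev₅ := ((tendsto_rpow_atTop (show 0 < 3 * a - 2 by linarith)).comp
    (tendsto_natCast_atTop_atTop (R := ℝ))).eventually_gt_atTop (4 * |Λ| / c)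
  obtain ⟨N, ⟨⟨⟨⟨⟨h₁, h₂⟩, h₃⟩, h₄⟩, h₅⟩, hN⟩⟩ := (((((hev₁.and hev₂).and hev₃).and hev₄).and
    hev₅).and (Filter.eventually_ne_atTop 0)).exists
  have hN0 : (0 : ℝ) < N := by exact_mod_cast Nat.pos_of_ne_zero hN
  have hpow : ∀ n : ℕ, ((N : ℝ) ^ a) ^ n = (N : ℝ) ^ (n * a) := fun n => by
    rw [← Real.rpow_mul_natCast hN0.le, mul_comm]
  have hinv : ∀ b : ℝ, (N : ℝ) ^ b / (N : ℝ) ^ 2 = (N : ℝ) ^ (b - 2) := fun b => by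
    rw [Real.rpow_sub hN0, Real.rpow_two]
  set t := c / (N : ℝ) ^ 2 with ht
  have ht' : t = c * (N : ℝ) ^ (-2 : ℝ) := by
    rw [ht, Real.rpow_neg hN0.le, Real.rpow_two, div_eq_mul_inv]
  set A := (N : ℝ) ^ a with hA
  have hAt : A ^ 2 * t = c * (N : ℝ) ^ (2 * a - 2) := by
    rw [← hinv, hpow, ht]
    push_cast
    ring
  have hAt' : A ^ 3 * t = c * (N : ℝ) ^ (3 * a - 2) := by
    rw [← hinv, hpow, ht]
    push_cast
    ring
  have h1 := H N A t hN (by positivity) (by positivity) (by rw [ht']; exact h₃)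
    (by rw [hA, ← Real.rpow_add hN0]; exact h₁)
    (by rw [mul_one, mul_assoc, hAt, ← mul_assoc]; exact h₂.le)
  have h2 := hlow N hN
  have h3 : A ^ 3 * (t / 2) ≤ A ^ 3 * ‖∫ u in (0 : ℝ)..t, phaseSum k 1 N u‖ :=
    mul_le_mul_of_nonneg_left h2 (by positivity)
  have h4 : C₂ * A ^ 5 * t ^ 2 ≤ 1 / 4 * (A ^ 3 * t) := by
    calc C₂ * A ^ 5 * t ^ 2 = C₂ * (A ^ 2 * t) * (A ^ 3 * t) := by ring
      _ = C₂ * c * (N : ℝ) ^ (2 * a - 2) * (A ^ 3 * t) := by rw [hAt]; ring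
      _ ≤ 1 / 4 * (A ^ 3 * t) := mul_le_mul_of_nonneg_right h₄.le (by positivity)
  have h5 : 4 * |Λ| < A ^ 3 * t := by
    rw [hAt', mul_comm c]
    rwa [Function.comp_apply, div_lt_iff₀ hc] at h₅
  norm_num at h1
  linarith [le_abs_self Λ]

end Conclusion

/-! ### Existence of resonant frequencies. -/

section Resonance

/-- Prepending a pair `(j, j)` changes neither alternating sum, so resonances pass to higher powers.
-/
theorem exists_resonant_tuple_add (d : ℕ) {J : Type} {k : J → Fin d → ℤ} {σ : ℕ} (j : J)
    (h : ∃ l : Tup J σ, Tup.alt k σ l = 0 ∧ Tup.alt (fun j => ∑ l, k j l ^ 2) σ l = 0) (n : ℕ) :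
    ∃ l : Tup J (σ + n),
      Tup.alt k (σ + n) l = 0 ∧ Tup.alt (fun j => ∑ l, k j l ^ 2) (σ + n) l = 0 := by
  induction n with
  | zero => exact h
  | succ n ih =>
    obtain ⟨l, h1, h2⟩ := ih
    refine ⟨(j, j, l), ?_, ?_⟩
    · change k j + (-k j + Tup.alt k (σ + n) l) = 0
      rw [h1, add_zero, add_neg_cancel]
    · change _ + (-_ + Tup.alt (fun j => ∑ l, k j l ^ 2) (σ + n) l) = 0
      rw [h2, add_zero, add_neg_cancel]

/-- For `d ≥ 2` the frequencies are the three nonzero corners of a unit square at the origin,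
resonant by Pythagoras. For `d = 1` a quintic resonance is needed: `1 - 4 + 2 - 5 + 6 = 0` and `1 -
16 + 4 - 25 + 36 = 0`. -/
theorem exists_resonant_tuple {d σ : ℕ} (h : 2 ≤ d * σ) :
    ∃ (J : Type) (_ : Fintype J) (k : J → Fin d → ℤ), (∀ j l, |k j l| ≤ (6 : ℕ)) ∧
      (∀ j, k j ≠ 0) ∧
      ∃ l : Tup J σ, Tup.alt k σ l = 0 ∧ Tup.alt (fun j => ∑ l, k j l ^ 2) σ l = 0 := by
  have hd : 1 ≤ d := Nat.pos_of_ne_zero fun h0 => by simp [h0] at h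
  have hσ : 1 ≤ σ := Nat.pos_of_ne_zero fun h0 => by simp [h0] at h
  by_cases h2 : 2 ≤ d
  · obtain ⟨d, rfl⟩ := Nat.exists_eq_add_of_le' h2
    obtain ⟨n, rfl⟩ := Nat.exists_eq_add_of_le hσ
    refine ⟨Fin 3, inferInstance, ![Pi.single 0 1, Pi.single 0 1 + Pi.single 1 1, Pi.single 1 1],
      ?_, ?_, exists_resonant_tuple_add (d + 2) (J := Fin 3) (σ := 1) 0
        ⟨((0 : Fin 3), (1 : Fin 3), (2 : Fin 3)), ?_, ?_⟩ n⟩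
    · intro j l
      have hs : ∀ i : Fin (d + 2), |(Pi.single i (1 : ℤ) : Fin (d + 2) → ℤ) l| ≤ 1 := fun i => by
        rw [Pi.single_apply]
        split_ifs <;> simp
      have h0 := hs 0
      have h1 := hs 1
      fin_cases j
      · exact h0.trans (by norm_num)
      · refine (abs_add_le _ _).trans ?_
        push_cast
        linarith
      · exact h1.trans (by norm_num)
    · intro j hj
      fin_cases j
      · simpa using congrFun hj 0
      · simpa using congrFun hj 0
      · simpa using congrFun hj 1
    · change (Pi.single 0 1 : Fin (d + 2) → ℤ)
        + (-(Pi.single 0 1 + Pi.single 1 1) + Pi.single 1 1) = 0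
      abel
    · change ∑ l, (Pi.single 0 1 : Fin (d + 2) → ℤ) l ^ 2
        + (-(∑ l, (Pi.single 0 1 + Pi.single 1 1 : Fin (d + 2) → ℤ) l ^ 2)
          + ∑ l, (Pi.single 1 1 : Fin (d + 2) → ℤ) l ^ 2) = 0
      have hsq : ∀ l, (Pi.single 0 1 + Pi.single 1 1 : Fin (d + 2) → ℤ) l ^ 2
          = (Pi.single 0 1 : Fin (d + 2) → ℤ) l ^ 2 + (Pi.single 1 1 : Fin (d + 2) → ℤ) l ^ 2 := by
        intro l
        rw [Pi.add_apply, Pi.single_apply, Pi.single_apply]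
        split_ifs with h0 h1 <;> simp_all
      rw [Finset.sum_congr rfl fun l _ => hsq l, Finset.sum_add_distrib]
      ring
  · obtain rfl : d = 1 := by omega
    obtain ⟨n, rfl⟩ := Nat.exists_eq_add_of_le (show 2 ≤ σ by omega)
    refine ⟨Fin 5, inferInstance, fun j _ => ![1, 4, 2, 5, 6] j, ?_, ?_,
      exists_resonant_tuple_add 1 (J := Fin 5) (σ := 2) 0
        ⟨((0 : Fin 5), (1 : Fin 5), (2 : Fin 5), (3 : Fin 5), (4 : Fin 5)), ?_, ?_⟩ n⟩
    · intro j l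
      fin_cases j <;> simp
    · intro j hj
      have h0 := congrFun hj 0
      fin_cases j <;> simp at h0
    · funext l
      change (1 : ℤ) + (-4 + (2 + (-5 + 6))) = 0
      norm_num
    · change ∑ _ : Fin 1, (1 : ℤ) ^ 2 + (-∑ _ : Fin 1, (4 : ℤ) ^ 2 + (∑ _ : Fin 1, (2 : ℤ) ^ 2
        + (-∑ _ : Fin 1, (5 : ℤ) ^ 2 + ∑ _ : Fin 1, (6 : ℤ) ^ 2))) = 0
      simp

theorem not_aprioriEstimate {d σ : ℕ} {Φ : SmoothTorus d → (Fin d → ℝ) → ℂ}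
    (hΦ : IsPowerLike Φ σ) {s : ℝ} (h : 2 ≤ d * σ ∧ s < 0 ∨ d = 1 ∧ σ = 1 ∧ s < -2 / 3)
    {p₁ p₂ : ℝ≥0∞} [Fact (1 ≤ p₁)] [Fact (1 ≤ p₂)] {r T : ℝ} (hT : 0 < T)
    {U : Set (FL d s p₁)} (hU : U ∈ 𝓝 0) {M : ℝ≥0 → ℝ≥0} (hM : Continuous M) :
    ¬ AprioriEstimate Φ s p₁ r p₂ T U M := by
  rcases h with ⟨h, hs⟩ | ⟨rfl, rfl, hs⟩
  · obtain ⟨J, _, k, hk, hk0, l, h1, h2⟩ := exists_resonant_tuple h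
    have hσ : 1 ≤ σ := Nat.pos_of_ne_zero fun h0 => by simp [h0] at h
    exact not_aprioriEstimate_of_resonant hk hk0 hσ l h1 h2 hΦ hs hT hU hM
  -- The frequencies are `1` and `2`, and the tuple is `1 - 2 + 1 = 0`; its phase `1 - 4 + 1` is not
  -- resonant.
  · refine not_aprioriEstimate_of_cubic (J := Fin 2) (k := fun j _ => (j : ℤ) + 1) (K := 2) ?_ ?_
      ((0 : Fin 2), (1 : Fin 2), (0 : Fin 2)) ?_ hΦ hs hT hU hM
    · intro j _
      fin_cases j <;> simp
    · intro j hj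
      have h0 := congrFun hj 0
      fin_cases j <;> simp at h0
    · funext l
      simp [Tup.alt]

theorem SobolevAprioriEstimate.aprioriEstimate {d : ℕ} {Φ : SmoothTorus d → (Fin d → ℝ) → ℂ}
    {s r T : ℝ} {M : ℝ≥0 → ℝ≥0} (h : SobolevAprioriEstimate Φ s r T M) :
    AprioriEstimate Φ s 2 r 2 T Set.univ M :=
  fun J ψ hψ u _ hu => h J ψ hψ u hu

end Resonance
end

end PeriodicNLS

open PeriodicNLS

theorem corollary1p2 (d σ : ℕ) (hd : 1 ≤ d) (hσ : 1 ≤ σ) (μ : ℝ) (hμ : μ = 1 ∨ μ = -1)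
    (p₁ p₂ : ℝ≥0∞) [Fact (1 ≤ p₁)] [Fact (1 ≤ p₂)] (s T : ℝ) (hT : 0 < T) :
    ((2 ≤ d * σ ∧ s < 0 ∨ d = 1 ∧ σ = 1 ∧ s < -2 / 3) →
      (∀ r : ℝ, ¬ ∃ U ∈ 𝓝 (0 : FL d s p₁), ∃ M : ℝ≥0 → ℝ≥0, Continuous M ∧
        AprioriEstimate (nlsTerm μ σ) s p₁ r p₂ T U M) ∧
      (∀ r : ℝ, ¬ ∃ M : ℝ≥0 → ℝ≥0, Continuous M ∧
        SobolevAprioriEstimate (d := d) (nlsTerm μ σ) s r T M)) ∧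
    ((2 ≤ d ∧ s < 0 ∨ d = 1 ∧ s < -2 / 3) →
      (∀ r : ℝ, ¬ ∃ U ∈ 𝓝 (0 : FL d s p₁), ∃ M : ℝ≥0 → ℝ≥0, Continuous M ∧
        AprioriEstimate (renormalizedTerm μ) s p₁ r p₂ T U M) ∧
      (∀ r : ℝ, ¬ ∃ M : ℝ≥0 → ℝ≥0, Continuous M ∧
        SobolevAprioriEstimate (d := d) (renormalizedTerm μ) s r T M)) := by
  have hμ' : |μ| = 1 := by rcases hμ with rfl | rfl <;> simp
  have key : ∀ {τ : ℕ} {Φ : SmoothTorus d → (Fin d → ℝ) → ℂ}, IsPowerLike Φ τ →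
      (2 ≤ d * τ ∧ s < 0 ∨ d = 1 ∧ τ = 1 ∧ s < -2 / 3) →
      (∀ r : ℝ, ¬ ∃ U ∈ 𝓝 (0 : FL d s p₁), ∃ M : ℝ≥0 → ℝ≥0, Continuous M ∧
        AprioriEstimate Φ s p₁ r p₂ T U M) ∧
      (∀ r : ℝ, ¬ ∃ M : ℝ≥0 → ℝ≥0, Continuous M ∧ SobolevAprioriEstimate Φ s r T M) := by
    intro τ Φ hΦ h
    refine ⟨?_, ?_⟩
    · rintro r ⟨U, hU, M, hM, hest⟩
      exact not_aprioriEstimate hΦ h hT hU hM hest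
    · rintro r ⟨M, hM, hest⟩
      exact not_aprioriEstimate hΦ h hT Filter.univ_mem hM hest.aprioriEstimate
  refine ⟨key (isPowerLike_nlsTerm d σ hμ'), fun h => key (isPowerLike_renormalizedTerm d hμ') ?_⟩
  rcases h with ⟨h, hs⟩ | ⟨h, hs⟩
  · exact Or.inl ⟨by omega, hs⟩
  · exact Or.inr ⟨h, rfl, hs⟩
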